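/- Let $n\ge 1$, let $\Omega\subset\mathbb R^n$ be a domain (a nonempty connected open set), and let $A=(a_{ij}):\Omega\to\mathbb R^{n\times n}$ be a measurable matrix-valued map that is elliptic: there is a continuous function $\lambda:\Omega\to[1,\infty)$ such that, with $H(x,\xi)=\langle A(x)\xi,\xi\rangle=\sum_{i,j}\xi_i a_{ij}(x)\xi_j$, $$\frac1{\lambda(x)}|\xi|^2\le H(x,\xi)\le\lambda(x)|\xi|^2\quad\text{for almost all }x\in\Omega\text{ and all }\xi\in\mathbb R^n.$$ For $x,y\in\Omega$ let $d_A(x,y)=\sup\{u(x)-u(y)\}$, the supremum being over all $u\in C(\Omega)\cap W^{1,2}_{\rm loc}(\Omega)$ with $H(z,\nabla u(z))\le 1$ for almost every $z\in\Omega$ ($\nabla u$ the weak gradient). For $u:\Omega\to\mathbb R$ and $K\subset\Omega$ put $$\mathrm{Lip}_{d_A}(u,K)=\sup_{x,y\in K,\ y\ne x}\frac{|u(y)-u(x)|}{d_A(x,y)},\qquad |Du|_{d_A}(x)=\lim_{r\to0}\mathrm{Lip}_{d_A}(u,B(x,r)\cap\Omega),$$ where $B(x,r)$ is the Euclidean ball.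 Say that $A$ is weak upper semicontinuous on $\Omega$ if for every $\xi\in S^{n-1}$ and almost every $x\in\Omega$ there is a Lebesgue null set $E$ with $$\limsup_{\Omega\setminus E\ni y\to x}\langle A(y)\xi,\xi\rangle\le\langle A(x)\xi,\xi\rangle .$$ Then $A$ is weak upper semicontinuous on $\Omega$ if and only if, for every $u\in C^1(\Omega)$, $|Du|_{d_A}^2(x)=H(x,\nabla u(x))$ for almost every $x\in\Omega$. -/

import Mathlib

open Set Filter Topology MeasureTheory
open scoped ENNReal ContDiff

namespace IntrinsicDistance

noncomputable section

/-- `L²_loc(Ω)`: square integrability on every compact subset of `Ω`. -/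
def MemL2Loc {n : ℕ} {F : Type*} [NormedAddCommGroup F]
    (Ω : Set (EuclideanSpace ℝ (Fin n))) (f : EuclideanSpace ℝ (Fin n) → F) : Prop :=
  ∀ K : Set (EuclideanSpace ℝ (Fin n)), K ⊆ Ω → IsCompact K → MemLp f 2 (volume.restrict K)

/-- `u` belongs to `W^{1,2}_loc(Ω)` and `g` is its weak gradient: both are in `L²_loc(Ω)` and
`∫_Ω u ∂ᵢφ = - ∫_Ω gᵢ φ` for all `φ ∈ C_c^∞(Ω)` and all `i`. -/
structure IsW12LocWithGradient {n : ℕ} (Ω : Set (EuclideanSpace ℝ (Fin n)))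
    (u : EuclideanSpace ℝ (Fin n) → ℝ)
    (g : EuclideanSpace ℝ (Fin n) → EuclideanSpace ℝ (Fin n)) : Prop where
  memL2Loc : MemL2Loc Ω u
  memL2Loc_gradient : MemL2Loc Ω g
  integral_eq : ∀ φ : EuclideanSpace ℝ (Fin n) → ℝ, ContDiff ℝ ∞ φ → HasCompactSupport φ →
    tsupport φ ⊆ Ω → ∀ i : Fin n,
      ∫ x in Ω, u x * fderiv ℝ φ x (EuclideanSpace.single i 1) = - ∫ x in Ω, g x i * φ x

/-- The Hamiltonian `H(x, ξ) = ⟨A(x) ξ, ξ⟩ = ∑ ξᵢ aᵢⱼ(x) ξⱼ`. -/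
def hamiltonian {n : ℕ} (A : EuclideanSpace ℝ (Fin n) → Matrix (Fin n) (Fin n) ℝ)
    (x ξ : EuclideanSpace ℝ (Fin n)) : ℝ :=
  ∑ i, ∑ j, ξ i * A x i j * ξ j

/-- The class `𝒜(Ω)` of diffusion matrices: (Lebesgue) measurable matrix-valued maps on `Ω` that
are elliptic, with a continuous ellipticity function `lam : Ω → [1, ∞)`. -/
structure IsDiffusionMatrix {n : ℕ} (Ω : Set (EuclideanSpace ℝ (Fin n)))
    (A : EuclideanSpace ℝ (Fin n) → Matrix (Fin n) (Fin n) ℝ) : Prop where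
  aemeasurable : ∀ i j, AEMeasurable (fun x => A x i j) (volume.restrict Ω)
  elliptic : ∃ lam : EuclideanSpace ℝ (Fin n) → ℝ, ContinuousOn lam Ω ∧ (∀ x ∈ Ω, 1 ≤ lam x) ∧
    ∀ᵐ x ∂(volume.restrict Ω), ∀ ξ : EuclideanSpace ℝ (Fin n),
      1 / lam x * ‖ξ‖ ^ 2 ≤ hamiltonian A x ξ ∧ hamiltonian A x ξ ≤ lam x * ‖ξ‖ ^ 2

/-- The competitors in the definition of the intrinsic distance: `u ∈ C(Ω) ∩ W^{1,2}_loc(Ω)` with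
`H(x, ∇u(x)) ≤ 1` for almost every `x ∈ Ω`, where `∇u` is the weak gradient. -/
def IsAdmissible {n : ℕ} (Ω : Set (EuclideanSpace ℝ (Fin n)))
    (A : EuclideanSpace ℝ (Fin n) → Matrix (Fin n) (Fin n) ℝ)
    (u : EuclideanSpace ℝ (Fin n) → ℝ) : Prop :=
  ContinuousOn u Ω ∧ ∃ g : EuclideanSpace ℝ (Fin n) → EuclideanSpace ℝ (Fin n),
    IsW12LocWithGradient Ω u g ∧ ∀ᵐ x ∂(volume.restrict Ω), hamiltonian A x (g x) ≤ 1

/-- The intrinsic distance `d_A(x, y) = sup {u(x) - u(y)}` over the admissible `u`, with values in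
`[0, ∞]`. (The constant `0` is admissible, so truncating negative differences is harmless.) -/
def intrinsicDist {n : ℕ} (Ω : Set (EuclideanSpace ℝ (Fin n)))
    (A : EuclideanSpace ℝ (Fin n) → Matrix (Fin n) (Fin n) ℝ)
    (x y : EuclideanSpace ℝ (Fin n)) : ℝ≥0∞ :=
  ⨆ (u : EuclideanSpace ℝ (Fin n) → ℝ) (_ : IsAdmissible Ω A u), ENNReal.ofReal (u x - u y)

/-- `Lip_{d_A}(u, K) = sup_{x, y ∈ K, y ≠ x} |u(y) - u(x)| / d_A(x, y)`. -/
def lipConst {n : ℕ} (Ω : Set (EuclideanSpace ℝ (Fin n)))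
    (A : EuclideanSpace ℝ (Fin n) → Matrix (Fin n) (Fin n) ℝ)
    (u : EuclideanSpace ℝ (Fin n) → ℝ) (K : Set (EuclideanSpace ℝ (Fin n))) : ℝ≥0∞ :=
  ⨆ (x ∈ K) (y ∈ K) (_ : y ≠ x), ENNReal.ofReal |u y - u x| / intrinsicDist Ω A x y

/-- The local Lipschitz constant `|Du|_{d_A}(x) = lim_{r → 0} Lip_{d_A}(u, B(x, r))`, with
Euclidean balls (intersected with `Ω`, which matters only for large `r`). The quantity is
monotone in `r`, so the limit is the infimum; see `tendsto_localLip`. -/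
def localLip {n : ℕ} (Ω : Set (EuclideanSpace ℝ (Fin n)))
    (A : EuclideanSpace ℝ (Fin n) → Matrix (Fin n) (Fin n) ℝ)
    (u : EuclideanSpace ℝ (Fin n) → ℝ) (x : EuclideanSpace ℝ (Fin n)) : ℝ≥0∞ :=
  ⨅ (r : ℝ) (_ : 0 < r), lipConst Ω A u (Metric.ball x r ∩ Ω)

theorem lipConst_mono {n : ℕ} (Ω : Set (EuclideanSpace ℝ (Fin n)))
    (A : EuclideanSpace ℝ (Fin n) → Matrix (Fin n) (Fin n) ℝ)
    (u : EuclideanSpace ℝ (Fin n) → ℝ) {K L : Set (EuclideanSpace ℝ (Fin n))} (h : K ⊆ L) :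
    lipConst Ω A u K ≤ lipConst Ω A u L := by
  unfold lipConst
  refine iSup₂_le fun x hx => iSup₂_le fun y hy => iSup_le fun hxy => ?_
  exact le_iSup₂_of_le x (h hx) (le_iSup₂_of_le y (h hy) (le_iSup_of_le hxy le_rfl))

theorem tendsto_localLip {n : ℕ} (Ω : Set (EuclideanSpace ℝ (Fin n)))
    (A : EuclideanSpace ℝ (Fin n) → Matrix (Fin n) (Fin n) ℝ)
    (u : EuclideanSpace ℝ (Fin n) → ℝ) (x : EuclideanSpace ℝ (Fin n)) :
    Tendsto (fun r : ℝ => lipConst Ω A u (Metric.ball x r ∩ Ω)) (𝓝[>] 0)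
      (𝓝 (localLip Ω A u x)) := by
  have hm : Monotone (fun r : ℝ => lipConst Ω A u (Metric.ball x r ∩ Ω)) := fun r s h =>
    lipConst_mono Ω A u (inter_subset_inter_left _ (Metric.ball_subset_ball h))
  have h := hm.tendsto_nhdsGT 0
  rw [sInf_image] at h
  exact h

/-- `f` is weak upper semicontinuous at `x`: there is a Lebesgue null set `E` with
`limsup_{Ω \ E ∋ y → x} f(y) ≤ f(x)`. -/
def WeakUSCAt {n : ℕ} (Ω : Set (EuclideanSpace ℝ (Fin n)))
    (f : EuclideanSpace ℝ (Fin n) → ℝ) (x : EuclideanSpace ℝ (Fin n)) : Prop :=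
  ∃ E : Set (EuclideanSpace ℝ (Fin n)), volume E = 0 ∧
    limsup (fun y => (f y : EReal)) (𝓝[Ω \ E] x) ≤ (f x : EReal)

/-- The matrix `A` is weak upper semicontinuous on `Ω`: for every `ξ ∈ S^{n-1}`, the function
`⟨A(·) ξ, ξ⟩` is weak upper semicontinuous at almost every `x ∈ Ω`. -/
def WeakUSCOn {n : ℕ} (Ω : Set (EuclideanSpace ℝ (Fin n)))
    (A : EuclideanSpace ℝ (Fin n) → Matrix (Fin n) (Fin n) ℝ) : Prop :=
  ∀ ξ ∈ Metric.sphere (0 : EuclideanSpace ℝ (Fin n)) 1,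
    ∀ᵐ x ∂(volume.restrict Ω), WeakUSCAt Ω (fun y => hamiltonian A y ξ) x

end

end IntrinsicDistance

/-! The bound H(x, ∇u) ≤ |Du|² holds almost everywhere for every continuous u, without
semicontinuity of A (`ae_hamiltonian_le_localLip_sq`). If the Lipschitz constant of u on a ball is
below c, then for z, y in the ball with u(y) < u(z) some admissible w satisfies u(z) - u(y) < c
(w(z) - w(y)), so u(z) + c (w - w(z)) solves H(·, ∇f) ≤ c², equals u at z and lies below u at y.
Suprema of infima of such functions over a countable dense set recover u
(`ae_hamiltonian_le_of_interpolation`). The inequality survives because Lipschitz subsolutions are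
stable under max, min and pointwise limits; for limits, gradients converge weakly and H(x, ·) is
convex (`IsLipSubsolution.of_tendsto`). Mollification shows that admissible functions are such
subsolutions locally (`IsAdmissible.exists_isLipSubsolution`).

Weak upper semicontinuity is what the opposite bound needs. If H(x, ∇u(x)) < c², then, ∇u being
continuous and A locally elliptic, H(y, ∇u(y)) ≤ c² for almost every y near x (`ae_localLip_sq_le`).
Truncating u / c by a cone makes it globally admissible without changing its increments near x,
whence |Du|(x) ≤ c (`localLip_le_of_ae_hamiltonian_le`).

Conversely, |Du| is always upper semicontinuous. The identity for linear u makes H(·, ξ) agree off a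
null set with such a function (`weakUSCOn_of_forall_localLip_sq_eq`). -/

namespace IntrinsicDistance

open scoped NNReal RealInnerProductSpace

section

variable {n : ℕ} {A : EuclideanSpace ℝ (Fin n) → Matrix (Fin n) (Fin n) ℝ}

/-! ### The quadratic form `H(x, ·)` -/

/-- The vector `Aₛ(x) η`, where `Aₛ` is the symmetric part of `A`. -/
noncomputable def symmApply (A : EuclideanSpace ℝ (Fin n) → Matrix (Fin n) (Fin n) ℝ)
    (x η : EuclideanSpace ℝ (Fin n)) : EuclideanSpace ℝ (Fin n) :=
  WithLp.toLp 2 fun i => (∑ j, (A x i j + A x j i) * η j) / 2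

theorem inner_symmApply (x ξ η : EuclideanSpace ℝ (Fin n)) :
    2 * ⟪symmApply A x η, ξ⟫ = ∑ i, ∑ j, (ξ i * A x i j * η j + η i * A x i j * ξ j) := by
  have h : 2 * ⟪symmApply A x η, ξ⟫ = ∑ i, ∑ j, (ξ i * A x i j * η j + ξ i * A x j i * η j) := by
    simp only [symmApply, PiLp.inner_apply, RCLike.inner_apply, conj_trivial, Finset.mul_sum]
    refine Finset.sum_congr rfl fun i _ => ?_
    rw [show ∀ a b : ℝ, 2 * (a * (b / 2)) = a * b by intros; ring, Finset.mul_sum]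
    exact Finset.sum_congr rfl fun j _ => by ring
  rw [h]
  simp only [Finset.sum_add_distrib]
  congr 1
  rw [Finset.sum_comm]
  exact Finset.sum_congr rfl fun i _ => Finset.sum_congr rfl fun j _ => by ring

theorem inner_symmApply_self (x ξ : EuclideanSpace ℝ (Fin n)) :
    ⟪symmApply A x ξ, ξ⟫ = hamiltonian A x ξ := by
  have h := inner_symmApply (A := A) x ξ ξ
  simp only [← two_mul, ← Finset.mul_sum] at h
  exact mul_left_cancel₀ two_ne_zero h

theorem hamiltonian_add_smul (x ξ η : EuclideanSpace ℝ (Fin n)) (t : ℝ) :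
    hamiltonian A x (ξ + t • η)
      = hamiltonian A x ξ + 2 * t * ⟪symmApply A x η, ξ⟫ + t ^ 2 * hamiltonian A x η := by
  rw [mul_right_comm, inner_symmApply]
  simp only [hamiltonian, Finset.mul_sum, Finset.sum_mul, ← Finset.sum_add_distrib]
  refine Finset.sum_congr rfl fun i _ => Finset.sum_congr rfl fun j _ => ?_
  simp only [PiLp.add_apply, PiLp.smul_apply, smul_eq_mul]
  ring

theorem hamiltonian_smul (x ξ : EuclideanSpace ℝ (Fin n)) (t : ℝ) :
    hamiltonian A x (t • ξ) = t ^ 2 * hamiltonian A x ξ := by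
  simp only [hamiltonian, Finset.mul_sum]
  refine Finset.sum_congr rfl fun i _ => Finset.sum_congr rfl fun j _ => ?_
  simp only [PiLp.smul_apply, smul_eq_mul]
  ring

theorem hamiltonian_neg (x ξ : EuclideanSpace ℝ (Fin n)) :
    hamiltonian A x (-ξ) = hamiltonian A x ξ := by
  simpa using hamiltonian_smul (A := A) x ξ (-1)

theorem hamiltonian_zero (x : EuclideanSpace ℝ (Fin n)) : hamiltonian A x 0 = 0 := by
  simp [hamiltonian]

theorem continuous_hamiltonian (x : EuclideanSpace ℝ (Fin n)) : Continuous (hamiltonian A x) := by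
  unfold hamiltonian
  fun_prop

theorem continuous_symmApply (x : EuclideanSpace ℝ (Fin n)) : Continuous (symmApply A x) := by
  unfold symmApply
  fun_prop

/-- Cauchy–Schwarz: the quadratic t ↦ H(x, ξ + tη) is nonnegative, so its discriminant is not
positive. -/
theorem inner_symmApply_sq_le {x : EuclideanSpace ℝ (Fin n)} (hx : ∀ ξ, 0 ≤ hamiltonian A x ξ)
    (ξ η : EuclideanSpace ℝ (Fin n)) :
    ⟪symmApply A x η, ξ⟫ ^ 2 ≤ hamiltonian A x η * hamiltonian A x ξ := by
  have h := discrim_le_zero (a := hamiltonian A x η) (b := 2 * ⟪symmApply A x η, ξ⟫)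
    (c := hamiltonian A x ξ) fun t => by
      have := hx (ξ + t • η)
      rw [hamiltonian_add_smul] at this
      linarith
  rw [discrim] at h
  linarith

theorem abs_inner_symmApply_le {x : EuclideanSpace ℝ (Fin n)} (hx : ∀ ξ, 0 ≤ hamiltonian A x ξ)
    (ξ η : EuclideanSpace ℝ (Fin n)) :
    |⟪symmApply A x η, ξ⟫| ≤ √(hamiltonian A x η) * √(hamiltonian A x ξ) := by
  rw [← Real.sqrt_mul (hx η)]
  exact Real.abs_le_sqrt (inner_symmApply_sq_le hx ξ η)

theorem sqrt_hamiltonian_add_le {x : EuclideanSpace ℝ (Fin n)} (hx : ∀ ξ, 0 ≤ hamiltonian A x ξ)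
    (ξ η : EuclideanSpace ℝ (Fin n)) :
    √(hamiltonian A x (ξ + η)) ≤ √(hamiltonian A x ξ) + √(hamiltonian A x η) := by
  rw [Real.sqrt_le_left (by positivity)]
  have h := hamiltonian_add_smul (A := A) x ξ η 1
  have h' := (abs_le.1 (abs_inner_symmApply_le hx ξ η)).2
  rw [one_smul] at h
  rw [h, add_sq, Real.sq_sqrt (hx ξ), Real.sq_sqrt (hx η)]
  linarith

/-- `H(x, ·)` is nonnegative and comparable to the Euclidean square norm with constant `M`. -/
def IsEllipticAt (A : EuclideanSpace ℝ (Fin n) → Matrix (Fin n) (Fin n) ℝ) (M : ℝ)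
    (x : EuclideanSpace ℝ (Fin n)) : Prop :=
  ∀ ξ : EuclideanSpace ℝ (Fin n), 0 ≤ hamiltonian A x ξ ∧
    ‖ξ‖ ^ 2 ≤ M * hamiltonian A x ξ ∧ hamiltonian A x ξ ≤ M * ‖ξ‖ ^ 2

theorem IsEllipticAt.sqrt_hamiltonian_le {M : ℝ} {x : EuclideanSpace ℝ (Fin n)}
    (h : IsEllipticAt A M x) (ξ : EuclideanSpace ℝ (Fin n)) :
    √(hamiltonian A x ξ) ≤ √M * ‖ξ‖ := by
  rw [← Real.sqrt_sq (norm_nonneg ξ), ← Real.sqrt_mul' _ (sq_nonneg _)]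
  exact Real.sqrt_le_sqrt (h ξ).2.2

theorem isEllipticAt_of_le {l M : ℝ} (hl : 1 ≤ l) (hM : l ≤ M) {x : EuclideanSpace ℝ (Fin n)}
    (h : ∀ ξ : EuclideanSpace ℝ (Fin n),
      1 / l * ‖ξ‖ ^ 2 ≤ hamiltonian A x ξ ∧ hamiltonian A x ξ ≤ l * ‖ξ‖ ^ 2) :
    IsEllipticAt A M x := fun ξ => by
  obtain ⟨h1, h2⟩ := h ξ
  have h0 : 0 ≤ hamiltonian A x ξ := le_trans (by positivity) h1
  refine ⟨h0, ?_, h2.trans (by gcongr)⟩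
  rw [div_mul_eq_mul_div, one_mul, div_le_iff₀ (by linarith)] at h1
  nlinarith

theorem IsDiffusionMatrix.exists_isEllipticAt {Ω : Set (EuclideanSpace ℝ (Fin n))}
    (hA : IsDiffusionMatrix Ω A) {S : Set (EuclideanSpace ℝ (Fin n))} (hS : IsCompact S)
    (hSΩ : S ⊆ Ω) :
    ∃ M : ℝ, 1 ≤ M ∧ ∀ᵐ x ∂(volume.restrict Ω), x ∈ S → IsEllipticAt A M x := by
  obtain ⟨l, hl, hl1, h⟩ := hA.elliptic
  obtain ⟨M, hM⟩ := (hS.image_of_continuousOn (hl.mono hSΩ)).bddAbove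
  refine ⟨max M 1, le_max_right _ _, ?_⟩
  filter_upwards [h] with x hx hxS
  exact isEllipticAt_of_le (hl1 x (hSΩ hxS))
    ((hM (mem_image_of_mem l hxS)).trans (le_max_left _ _)) hx

theorem IsDiffusionMatrix.ae_hamiltonian_nonneg {Ω : Set (EuclideanSpace ℝ (Fin n))}
    (hΩ : MeasurableSet Ω) (hA : IsDiffusionMatrix Ω A) :
    ∀ᵐ x ∂(volume.restrict Ω), ∀ ξ, 0 ≤ hamiltonian A x ξ := by
  obtain ⟨l, hl, hl1, h⟩ := hA.elliptic
  filter_upwards [h, ae_restrict_mem hΩ] with x hx hxΩ ξ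
  have := hl1 x hxΩ
  exact le_trans (by positivity) (hx ξ).1

/-! ### Gradients -/

theorem lipschitzWith_norm_gradient_le {K : ℝ≥0} {f : EuclideanSpace ℝ (Fin n) → ℝ}
    (hf : LipschitzWith K f) (x : EuclideanSpace ℝ (Fin n)) : ‖gradient f x‖ ≤ K := by
  rw [gradient, LinearIsometryEquiv.norm_map]
  exact norm_fderiv_le_of_lipschitz ℝ hf

theorem gradient_apply (f : EuclideanSpace ℝ (Fin n) → ℝ) (x : EuclideanSpace ℝ (Fin n))
    (i : Fin n) : gradient f x i = fderiv ℝ f x (EuclideanSpace.single i 1) := by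
  rw [← inner_gradient_left, EuclideanSpace.inner_single_right]
  simp

theorem measurable_gradient (f : EuclideanSpace ℝ (Fin n) → ℝ) : Measurable (gradient f) :=
  (InnerProductSpace.toDual ℝ _).symm.continuous.measurable.comp (measurable_fderiv ℝ f)

theorem gradient_const_add (f : EuclideanSpace ℝ (Fin n) → ℝ) (c : ℝ)
    (x : EuclideanSpace ℝ (Fin n)) : gradient (fun y => c + f y) x = gradient f x := by
  rw [gradient, gradient, fderiv_const_add]

theorem gradient_const_mul (f : EuclideanSpace ℝ (Fin n) → ℝ) (c : ℝ)
    (x : EuclideanSpace ℝ (Fin n)) : gradient (fun y => c * f y) x = c • gradient f x := by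
  rw [gradient, gradient, show (fun y => c * f y) = c • f from rfl, fderiv_const_smul_field]
  simp

theorem gradient_neg_fun (f : EuclideanSpace ℝ (Fin n) → ℝ)
    (x : EuclideanSpace ℝ (Fin n)) : gradient (fun y => -f y) x = -gradient f x := by
  simpa using gradient_const_mul f (-1) x

/-- If `f ≤ g` touch at `x`, their gradients agree there. -/
theorem gradient_eq_of_le_of_eq {f g : EuclideanSpace ℝ (Fin n) → ℝ}
    {x : EuclideanSpace ℝ (Fin n)} (hf : DifferentiableAt ℝ f x) (hg : DifferentiableAt ℝ g x)
    (hfg : ∀ y, f y ≤ g y) (hx : f x = g x) : gradient f x = gradient g x := by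
  have hmin : IsLocalMin (g - f) x := Eventually.of_forall fun y => by
    simpa [hx] using hfg y
  have := hmin.fderiv_eq_zero
  rw [fderiv_sub hg hf, sub_eq_zero] at this
  rw [gradient, gradient, this]

/-- A globally Lipschitz function is in `W^{1,2}_loc`, with its a.e. gradient as weak gradient. -/
theorem _root_.LipschitzWith.isW12LocWithGradient {K : ℝ≥0} {f : EuclideanSpace ℝ (Fin n) → ℝ}
    (hf : LipschitzWith K f) {Ω : Set (EuclideanSpace ℝ (Fin n))} :
    IsW12LocWithGradient Ω f (gradient f) where
  memL2Loc := fun S _ hS => by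
    obtain ⟨C, hC⟩ := (hS.image hf.continuous).isBounded.exists_norm_le
    have : IsFiniteMeasure (volume.restrict S) := ⟨by simpa using hS.measure_lt_top⟩
    refine MemLp.of_bound hf.continuous.aestronglyMeasurable C ?_
    filter_upwards [ae_restrict_mem hS.measurableSet] with x hx
    exact hC _ (mem_image_of_mem f hx)
  memL2Loc_gradient := fun S _ hS => by
    have : IsFiniteMeasure (volume.restrict S) := ⟨by simpa using hS.measure_lt_top⟩
    exact MemLp.of_bound (measurable_gradient f).aestronglyMeasurable K
      (Eventually.of_forall fun x => lipschitzWith_norm_gradient_le hf x)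
  integral_eq := fun φ hφ hφc hφΩ i => by
    obtain ⟨C, hC⟩ := hφ.lipschitzWith_of_hasCompactSupport hφc (by simp)
    have key := hf.integral_lineDeriv_mul_eq hC hφc (EuclideanSpace.single i (1 : ℝ))
      (μ := (volume : Measure (EuclideanSpace ℝ (Fin n))))
    have hd : ∀ x, x ∉ Ω → φ x = 0 := fun x hx => by
      by_contra h
      exact hx (hφΩ (subset_tsupport φ h))
    have hd' : ∀ x, x ∉ Ω → fderiv ℝ φ x = 0 := fun x hx => by
      by_contra h
      exact hx (hφΩ (support_fderiv_subset ℝ h))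
    rw [setIntegral_eq_integral_of_forall_compl_eq_zero fun x hx => by simp [hd' x hx],
      setIntegral_eq_integral_of_forall_compl_eq_zero fun x hx => by simp [hd x hx]]
    have h1 : ∫ x, gradient f x i * φ x
        = ∫ x, lineDeriv ℝ f x (EuclideanSpace.single i (1 : ℝ)) * φ x := by
      refine integral_congr_ae ?_
      filter_upwards [hf.ae_differentiableAt] with x hx
      rw [hx.lineDeriv_eq_fderiv, gradient_apply]
    rw [h1, key, ← integral_neg]
    refine integral_congr_ae (Eventually.of_forall fun x => ?_)
    have := ((hφ.differentiable (by simp)) x).lineDeriv_eq_fderiv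
      (v := -(EuclideanSpace.single i (1 : ℝ)))
    simp only [this, map_neg]
    ring

end

section

variable {n : ℕ} {A : EuclideanSpace ℝ (Fin n) → Matrix (Fin n) (Fin n) ℝ}

/-! ### Weak convergence of the gradients of equi-Lipschitz functions -/

section WeakConvergence

variable {K : ℝ≥0} {f : ℕ → EuclideanSpace ℝ (Fin n) → ℝ} {F : EuclideanSpace ℝ (Fin n) → ℝ}

theorem lipschitzWith_of_tendsto (hf : ∀ k, LipschitzWith K (f k))
    (h : ∀ x, Tendsto (fun k => f k x) atTop (𝓝 (F x))) : LipschitzWith K F :=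
  LipschitzWith.of_dist_le_mul fun x y =>
    le_of_tendsto ((h x).dist (h y)) (Eventually.of_forall fun k => (hf k).dist_le_mul x y)

/-- Integration by parts moves the derivative onto φ; pointwise convergence and domination then
suffice. -/
theorem tendsto_integral_lineDeriv_mul_of_contDiff (hf : ∀ k, LipschitzWith K (f k))
    (h : ∀ x, Tendsto (fun k => f k x) atTop (𝓝 (F x))) {φ : EuclideanSpace ℝ (Fin n) → ℝ}
    (hφ : ContDiff ℝ ∞ φ) (hφc : HasCompactSupport φ) (v : EuclideanSpace ℝ (Fin n)) :
    Tendsto (fun k => ∫ x, lineDeriv ℝ (f k) x v * φ x) atTop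
      (𝓝 (∫ x, lineDeriv ℝ F x v * φ x)) := by
  obtain ⟨C, hC⟩ := hφ.lipschitzWith_of_hasCompactSupport hφc (by simp)
  have hF := lipschitzWith_of_tendsto hf h
  rw [hF.integral_lineDeriv_mul_eq hC hφc]
  simp_rw [fun k => (hf k).integral_lineDeriv_mul_eq hC hφc (μ := volume) v]
  have hd : ∀ x, lineDeriv ℝ φ x (-v) = fderiv ℝ φ x (-v) := fun x =>
    (hφ.differentiable (by simp) x).lineDeriv_eq_fderiv
  simp_rw [hd]
  have hcont : Continuous fun x => fderiv ℝ φ x (-v) :=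
    (hφ.continuous_fderiv (by simp)).clm_apply continuous_const
  -- Convergence at the origin bounds the values there, and the common Lipschitz constant turns this
  -- into the growth bound M + K‖x‖ for all k.
  obtain ⟨M, hM⟩ := (h 0).abs.bddAbove_range
  refine tendsto_integral_of_dominated_convergence
    (fun x => ‖fderiv ℝ φ x (-v)‖ * (M + K * ‖x‖)) ?_ ?_ ?_ ?_
  · exact fun k => (hcont.mul (hf k).continuous).aestronglyMeasurable
  · refine Continuous.integrable_of_hasCompactSupport (by fun_prop) ?_
    exact ((hφc.fderiv_apply ℝ (-v)).norm).mul_right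
  · refine fun k => Eventually.of_forall fun x => ?_
    rw [norm_mul]
    gcongr
    have h1 := (hf k).dist_le_mul x 0
    rw [dist_zero_right, Real.dist_eq] at h1
    have h2 : |f k 0| ≤ M := hM (mem_range_self k)
    rw [Real.norm_eq_abs]
    calc |f k x| = |f k 0 + (f k x - f k 0)| := by ring_nf
      _ ≤ |f k 0| + |f k x - f k 0| := abs_add_le _ _
      _ ≤ M + K * ‖x‖ := add_le_add h2 h1
  · exact Eventually.of_forall fun x => (h x).const_mul _

theorem integrable_lineDeriv_mul {g ψ : EuclideanSpace ℝ (Fin n) → ℝ} (hg : LipschitzWith K g)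
    (hψ : Integrable ψ) (v : EuclideanSpace ℝ (Fin n)) :
    Integrable fun x => lineDeriv ℝ g x v * ψ x :=
  hψ.bdd_mul (aestronglyMeasurable_lineDeriv hg.continuous volume)
    (Eventually.of_forall fun _ => norm_lineDeriv_le_of_lipschitz ℝ hg)

/-- All derivatives are bounded by K‖v‖, so approximating ψ in L¹ by a smooth compactly supported φ
costs an error uniform in k. -/
theorem tendsto_integral_lineDeriv_mul (hf : ∀ k, LipschitzWith K (f k))
    (h : ∀ x, Tendsto (fun k => f k x) atTop (𝓝 (F x))) {ψ : EuclideanSpace ℝ (Fin n) → ℝ}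
    (hψ : Integrable ψ) (v : EuclideanSpace ℝ (Fin n)) :
    Tendsto (fun k => ∫ x, lineDeriv ℝ (f k) x v * ψ x) atTop
      (𝓝 (∫ x, lineDeriv ℝ F x v * ψ x)) := by
  have hF := lipschitzWith_of_tendsto hf h
  rw [Metric.tendsto_atTop]
  intro ε hε
  set δ : ℝ := ε / (3 * (K * ‖v‖ + 1)) with hδ
  have hKv : 0 ≤ K * ‖v‖ := by positivity
  have hδ0 : 0 < δ := by positivity
  have hδε : K * ‖v‖ * δ < ε / 3 := by
    rw [hδ, ← mul_div_assoc, div_lt_div_iff₀ (by positivity) (by positivity)]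
    nlinarith
  obtain ⟨φ, hφc, hφ, hφψ⟩ :=
    (memLp_one_iff_integrable.2 hψ).exist_eLpNorm_sub_le ENNReal.one_ne_top le_rfl hδ0
  have hφi : Integrable φ := hφ.continuous.integrable_of_hasCompactSupport hφc
  have hint : ∫ x, ‖ψ x - φ x‖ ≤ δ := by
    change ∫ x, ‖(ψ - φ) x‖ ≤ δ
    rw [integral_norm_eq_lintegral_enorm (hψ.sub hφi).aestronglyMeasurable]
    refine ENNReal.toReal_le_of_le_ofReal hδ0.le ?_
    simpa [eLpNorm_one_eq_lintegral_enorm] using hφψ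
  have happrox : ∀ g : EuclideanSpace ℝ (Fin n) → ℝ, LipschitzWith K g →
      dist (∫ x, lineDeriv ℝ g x v * ψ x) (∫ x, lineDeriv ℝ g x v * φ x) < ε / 3 := by
    intro g hg
    rw [dist_eq_norm, ← integral_sub (integrable_lineDeriv_mul hg hψ v)
      (integrable_lineDeriv_mul hg hφi v)]
    refine lt_of_le_of_lt ?_ hδε
    calc ‖∫ x, (lineDeriv ℝ g x v * ψ x - lineDeriv ℝ g x v * φ x)‖
        ≤ ∫ x, K * ‖v‖ * ‖ψ x - φ x‖ := by
          refine norm_integral_le_of_norm_le ((hψ.sub hφi).norm.const_mul _)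
            (Eventually.of_forall fun x => ?_)
          rw [← mul_sub, norm_mul]
          gcongr
          exact norm_lineDeriv_le_of_lipschitz ℝ hg
      _ ≤ K * ‖v‖ * δ := by
          rw [integral_const_mul]
          gcongr
  obtain ⟨N, hN⟩ := Metric.tendsto_atTop.1
    (tendsto_integral_lineDeriv_mul_of_contDiff hf h hφ hφc v) (ε / 3) (by positivity)
  refine ⟨N, fun k hk => ?_⟩
  have h1 := happrox (f k) (hf k)
  have h2 := hN k hk
  have h3 := happrox F hF
  rw [dist_comm] at h3
  calc _ ≤ _ := dist_triangle4 _ _ _ _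
    _ < ε := by linarith

end WeakConvergence

/-! ### Lipschitz subsolutions of `H(x, ∇f) ≤ c²` -/

/-- `A` is measurable and uniformly elliptic on the finite-measure set `B`. -/
structure UniformlyEllipticOn (A : EuclideanSpace ℝ (Fin n) → Matrix (Fin n) (Fin n) ℝ) (M : ℝ)
    (B : Set (EuclideanSpace ℝ (Fin n))) : Prop where
  nonneg : 0 ≤ M
  measure_ne_top : volume B ≠ ⊤
  aemeasurable : ∀ i j, AEMeasurable (fun x => A x i j) (volume.restrict B)
  isEllipticAt : ∀ᵐ x ∂(volume.restrict B), IsEllipticAt A M x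

/-- `f` is globally `K`-Lipschitz and satisfies `H(x, ∇f(x)) ≤ c²` a.e. on `B`. -/
structure IsLipSubsolution (A : EuclideanSpace ℝ (Fin n) → Matrix (Fin n) (Fin n) ℝ) (c : ℝ)
    (K : ℝ≥0) (B : Set (EuclideanSpace ℝ (Fin n))) (f : EuclideanSpace ℝ (Fin n) → ℝ) : Prop where
  lipschitzWith : LipschitzWith K f
  ae_le : ∀ᵐ x ∂(volume.restrict B), hamiltonian A x (gradient f x) ≤ c ^ 2

variable {M c : ℝ} {K : ℝ≥0} {B : Set (EuclideanSpace ℝ (Fin n))}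

theorem IsLipSubsolution.neg {f : EuclideanSpace ℝ (Fin n) → ℝ} (hf : IsLipSubsolution A c K B f) :
    IsLipSubsolution A c K B fun x => -f x where
  lipschitzWith := hf.lipschitzWith.neg
  ae_le := by
    filter_upwards [hf.ae_le] with x hx
    rwa [gradient_neg_fun, hamiltonian_neg]

/-- At almost every point all three functions are differentiable, and the maximum touches one of f,
g from above, hence shares its gradient. -/
theorem IsLipSubsolution.sup {f g : EuclideanSpace ℝ (Fin n) → ℝ}
    (hf : IsLipSubsolution A c K B f) (hg : IsLipSubsolution A c K B g) :
    IsLipSubsolution A c K B fun x => max (f x) (g x) where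
  lipschitzWith := by simpa using hf.lipschitzWith.max hg.lipschitzWith
  ae_le := by
    have hmax : LipschitzWith K fun x => max (f x) (g x) := by
      simpa using hf.lipschitzWith.max hg.lipschitzWith
    filter_upwards [hf.ae_le, hg.ae_le, ae_restrict_of_ae hf.lipschitzWith.ae_differentiableAt,
      ae_restrict_of_ae hg.lipschitzWith.ae_differentiableAt,
      ae_restrict_of_ae hmax.ae_differentiableAt] with x h1 h2 h3 h4 h5
    rcases le_total (f x) (g x) with h | h
    · rwa [← gradient_eq_of_le_of_eq h4 h5 (fun y => le_max_right _ _) (by simp [h])]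
    · rwa [← gradient_eq_of_le_of_eq h3 h5 (fun y => le_max_left _ _) (by simp [h])]

theorem IsLipSubsolution.inf {f g : EuclideanSpace ℝ (Fin n) → ℝ}
    (hf : IsLipSubsolution A c K B f) (hg : IsLipSubsolution A c K B g) :
    IsLipSubsolution A c K B fun x => min (f x) (g x) := by
  simpa [max_neg_neg] using (hf.neg.sup hg.neg).neg

theorem integrableOn_symmApply_apply (hA : UniformlyEllipticOn A M B)
    (η : EuclideanSpace ℝ (Fin n)) (i : Fin n) :
    IntegrableOn (fun x => symmApply A x η i) B := by
  have : IsFiniteMeasure (volume.restrict B) := ⟨by simpa using hA.measure_ne_top.lt_top⟩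
  have hmeas : AEMeasurable (fun x => symmApply A x η i) (volume.restrict B) := by
    simp only [symmApply]
    exact (Finset.aemeasurable_fun_sum _ fun j _ =>
      ((hA.aemeasurable i j).add (hA.aemeasurable j i)).mul_const _).div_const _
  refine Integrable.of_bound hmeas.aestronglyMeasurable (√M * ‖η‖ * (√M * 1)) ?_
  filter_upwards [hA.isEllipticAt] with x hx
  have h := abs_inner_symmApply_le (fun ξ => (hx ξ).1) (EuclideanSpace.single i (1 : ℝ)) η
  rw [EuclideanSpace.inner_single_right] at h
  have h1 := hx.sqrt_hamiltonian_le η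
  have h2 := hx.sqrt_hamiltonian_le (EuclideanSpace.single i (1 : ℝ))
  simp only [PiLp.norm_single, norm_one, one_mul, conj_trivial] at h h2
  exact h.trans (mul_le_mul h1 h2 (Real.sqrt_nonneg _) (by positivity))

theorem integrableOn_inner_symmApply (hA : UniformlyEllipticOn A M B)
    {f : EuclideanSpace ℝ (Fin n) → ℝ} (hf : LipschitzWith K f) (η : EuclideanSpace ℝ (Fin n)) :
    IntegrableOn (fun x => ⟪symmApply A x η, gradient f x⟫) B := by
  simp only [PiLp.inner_apply, RCLike.inner_apply, conj_trivial]
  refine integrable_finsetSum _ fun i _ =>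
    (integrableOn_symmApply_apply hA η i).bdd_mul (c := K) ?_
      (Eventually.of_forall fun x => ?_)
  · exact (((EuclideanSpace.proj i).continuous.measurable.comp
      (measurable_gradient f))).aestronglyMeasurable
  · exact (PiLp.norm_apply_le (gradient f x) i).trans (lipschitzWith_norm_gradient_le hf x)

/-- Exhibits the integral as a pairing of the partial derivatives with fixed L¹ functions, the form
to which weak convergence applies. -/
theorem setIntegral_inner_symmApply (hA : UniformlyEllipticOn A M B)
    {f : EuclideanSpace ℝ (Fin n) → ℝ} (hf : LipschitzWith K f) (η : EuclideanSpace ℝ (Fin n))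
    {S : Set (EuclideanSpace ℝ (Fin n))} (hS : MeasurableSet S) (hSB : S ⊆ B) :
    ∫ x in S, ⟪symmApply A x η, gradient f x⟫ = ∑ i, ∫ x, lineDeriv ℝ f x
      (EuclideanSpace.single i (1 : ℝ)) * S.indicator (fun x => symmApply A x η i) x := by
  rw [← integral_finsetSum _ fun i _ => integrable_lineDeriv_mul hf
    (((integrableOn_symmApply_apply hA η i).mono_set hSB).integrable_indicator hS) _,
    ← integral_indicator hS]
  refine integral_congr_ae ?_
  filter_upwards [hf.ae_differentiableAt] with x hx
  by_cases hxS : x ∈ S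
  · simp only [hxS, indicator_of_mem, PiLp.inner_apply, RCLike.inner_apply, conj_trivial,
      hx.lineDeriv_eq_fderiv, gradient_apply]
  · simp [hxS]

/-- By duality, H(x, p) ≤ c² amounts to the inequalities ⟨Aₛη, p⟩ ≤ c √H(x, η) for all η:
Cauchy–Schwarz gives one direction, η = p the other. They are linear in p, so they pass to weak
limits once integrated over measurable sets. -/
theorem IsLipSubsolution.of_tendsto (hA : UniformlyEllipticOn A M B) (hB : MeasurableSet B)
    (hc : 0 ≤ c)
    {f : ℕ → EuclideanSpace ℝ (Fin n) → ℝ} {F : EuclideanSpace ℝ (Fin n) → ℝ}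
    (hf : ∀ k, IsLipSubsolution A c K B (f k))
    (h : ∀ x, Tendsto (fun k => f k x) atTop (𝓝 (F x))) : IsLipSubsolution A c K B F := by
  have hF : LipschitzWith K F := lipschitzWith_of_tendsto (fun k => (hf k).lipschitzWith) h
  refine ⟨hF, ?_⟩
  have : IsFiniteMeasure (volume.restrict B) := ⟨by simpa using hA.measure_ne_top.lt_top⟩
  have key : ∀ η : EuclideanSpace ℝ (Fin n), ∀ᵐ x ∂(volume.restrict B),
      ⟪symmApply A x η, gradient F x⟫ ≤ c * √(hamiltonian A x η) := by
    intro η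
    have hs : IntegrableOn (fun x => c * √(hamiltonian A x η)) B := by
      have hm : AEMeasurable (fun x => c * √(hamiltonian A x η)) (volume.restrict B) := by
        refine (Real.continuous_sqrt.measurable.comp_aemeasurable ?_).const_mul c
        exact Finset.aemeasurable_fun_sum _ fun i _ => Finset.aemeasurable_fun_sum _ fun j _ =>
          ((hA.aemeasurable i j).const_mul _).mul_const _
      refine Integrable.of_bound hm.aestronglyMeasurable (c * (√M * ‖η‖)) ?_
      filter_upwards [hA.isEllipticAt] with x hx
      rw [Real.norm_of_nonneg (by positivity)]
      gcongr
      exact hx.sqrt_hamiltonian_le η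
    refine ae_le_of_forall_setIntegral_le (integrableOn_inner_symmApply hA hF η) hs
      fun S hS _ => ?_
    rw [Measure.restrict_restrict hS]
    have hSB := hS.inter hB
    have hlim : Tendsto (fun k => ∫ x in S ∩ B, ⟪symmApply A x η, gradient (f k) x⟫) atTop
        (𝓝 (∫ x in S ∩ B, ⟪symmApply A x η, gradient F x⟫)) := by
      simp_rw [setIntegral_inner_symmApply hA hF η hSB inter_subset_right,
        fun k => setIntegral_inner_symmApply hA (hf k).lipschitzWith η hSB inter_subset_right]
      exact tendsto_finsetSum _ fun i _ => tendsto_integral_lineDeriv_mul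
        (fun k => (hf k).lipschitzWith) h
        (((integrableOn_symmApply_apply hA η i).mono_set
          inter_subset_right).integrable_indicator hSB) _
    refine le_of_tendsto hlim (Eventually.of_forall fun k => ?_)
    refine setIntegral_mono_ae_restrict
      ((integrableOn_inner_symmApply hA (hf k).lipschitzWith η).mono_set inter_subset_right)
      (hs.mono_set inter_subset_right) (ae_restrict_of_ae_restrict_of_subset inter_subset_right ?_)
    filter_upwards [(hf k).ae_le, hA.isEllipticAt] with x hx hxe
    have h1 := (abs_le.1 (abs_inner_symmApply_le (fun ξ => (hxe ξ).1) (gradient (f k) x) η)).2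
    refine h1.trans ?_
    rw [mul_comm]
    gcongr
    exact (Real.sqrt_le_left hc).2 hx
  -- The null set in `key` depends on η. A countable dense set and continuity in η remove this
  -- dependence, so that η may be taken to be ∇F(x).
  obtain ⟨D, hDc, hDd⟩ := TopologicalSpace.exists_countable_dense (EuclideanSpace ℝ (Fin n))
  filter_upwards [(ae_ball_iff hDc).2 fun η _ => key η, hA.isEllipticAt] with x hx hxe
  have hall : ∀ η, ⟪symmApply A x η, gradient F x⟫ ≤ c * √(hamiltonian A x η) := fun η =>
    hDd.induction (P := fun η => ⟪symmApply A x η, gradient F x⟫ ≤ c * √(hamiltonian A x η)) hx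
      (isClosed_le ((continuous_symmApply x).inner continuous_const)
        ((continuous_hamiltonian x).sqrt.const_mul c)) η
  have h1 := hall (gradient F x)
  rw [inner_symmApply_self] at h1
  have h0 := (hxe (gradient F x)).1
  by_contra! hlt
  have h2 : c < √(hamiltonian A x (gradient F x)) := Real.lt_sqrt_of_sq_lt hlt
  have h3 := Real.mul_self_sqrt h0
  nlinarith

theorem IsLipSubsolution.ciSup (hA : UniformlyEllipticOn A M B) (hB : MeasurableSet B)
    (hc : 0 ≤ c)
    {f : ℕ → EuclideanSpace ℝ (Fin n) → ℝ} (hf : ∀ k, IsLipSubsolution A c K B (f k))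
    (h : ∀ x, BddAbove (range fun k => f k x)) : IsLipSubsolution A c K B fun x => ⨆ k, f k x := by
  have hp : ∀ k, IsLipSubsolution A c K B fun x => partialSups (fun i => f i x) k := by
    intro k
    induction k with
    | zero => simpa using hf 0
    | succ k ih => simpa [partialSups_add_one] using ih.sup (hf (k + 1))
  refine IsLipSubsolution.of_tendsto hA hB hc hp fun x => ?_
  rw [← ciSup_partialSups_eq (h x)]
  exact tendsto_atTop_ciSup (partialSups _).monotone (bddAbove_range_partialSups.2 (h x))

theorem IsLipSubsolution.ciInf (hA : UniformlyEllipticOn A M B) (hB : MeasurableSet B)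
    (hc : 0 ≤ c)
    {f : ℕ → EuclideanSpace ℝ (Fin n) → ℝ} (hf : ∀ k, IsLipSubsolution A c K B (f k))
    (h : ∀ x, BddBelow (range fun k => f k x)) : IsLipSubsolution A c K B fun x => ⨅ k, f k x := by
  have h1 := (IsLipSubsolution.ciSup hA hB hc (fun k => (hf k).neg) fun x => by
    obtain ⟨C, hC⟩ := h x
    exact ⟨-C, forall_mem_range.2 fun k => neg_le_neg (hC (mem_range_self k))⟩).neg
  convert h1 using 2 with x
  rw [iInf, Real.sInf_def, iSup]
  congr 2
  ext y
  simp [neg_eq_iff_eq_neg]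

end

section

variable {n : ℕ} {A : EuclideanSpace ℝ (Fin n) → Matrix (Fin n) (Fin n) ℝ}

/-! ### Continuous functions with bounded weak gradient -/

section Mollification

open scoped Convolution
open ContinuousLinearMap (lsmul)

variable {Ω : Set (EuclideanSpace ℝ (Fin n))} {u : EuclideanSpace ℝ (Fin n) → ℝ}
  {g : EuclideanSpace ℝ (Fin n) → EuclideanSpace ℝ (Fin n)} {q : EuclideanSpace ℝ (Fin n)}
  {R C : ℝ}

/-- The factor n is crude but harmless: it enters only the Lipschitz constant, not the bound on H.
-/
theorem norm_le_of_norm_apply_single_le {L : EuclideanSpace ℝ (Fin n) →L[ℝ] ℝ} (hC : 0 ≤ C)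
    (h : ∀ i, ‖L (EuclideanSpace.single i 1)‖ ≤ C) : ‖L‖ ≤ n * C := by
  refine L.opNorm_le_bound (by positivity) fun v => ?_
  have hv : v = ∑ i, v i • EuclideanSpace.single i (1 : ℝ) := by
    simpa using ((EuclideanSpace.basisFun (Fin n) ℝ).sum_repr v).symm
  conv_lhs => rw [hv]
  rw [map_sum]
  calc ‖∑ i, L (v i • EuclideanSpace.single i (1 : ℝ))‖
      ≤ ∑ _i : Fin n, C * ‖v‖ := norm_sum_le_of_le _ fun i _ => by
        rw [map_smul, norm_smul, mul_comm]
        exact mul_le_mul (h i) (PiLp.norm_apply_le v i) (norm_nonneg _) hC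
    _ = n * C * ‖v‖ := by simp [mul_assoc]

/-- With φ a reflected and translated mollifier, this bounds a partial derivative of the mollified
u. The cutoff to the closed ball makes u integrable on the whole space and is invisible to φ. -/
theorem norm_integral_mul_fderiv_le (hΩ : IsOpen Ω) (hug : IsW12LocWithGradient Ω u g)
    (hR : Metric.closedBall q R ⊆ Ω)
    (hg : ∀ᵐ x ∂(volume.restrict Ω), x ∈ Metric.ball q R → ‖g x‖ ≤ C) (hC : 0 ≤ C)
    {φ : EuclideanSpace ℝ (Fin n) → ℝ} (hφ : ContDiff ℝ ∞ φ) (hφc : HasCompactSupport φ)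
    (hφR : tsupport φ ⊆ Metric.ball q R) (hφ0 : ∀ x, 0 ≤ φ x) (hφ1 : ∫ x, φ x = 1) (i : Fin n) :
    ‖∫ x, (Metric.closedBall q R).indicator u x * fderiv ℝ φ x (EuclideanSpace.single i 1)‖
      ≤ C := by
  have hBΩ : Metric.ball q R ⊆ Ω := Metric.ball_subset_closedBall.trans hR
  have hφi : Integrable φ := hφ.continuous.integrable_of_hasCompactSupport hφc
  have h1 := hug.integral_eq φ hφ hφc (hφR.trans hBΩ) i
  have h2 : ∫ x, (Metric.closedBall q R).indicator u x * fderiv ℝ φ x (EuclideanSpace.single i 1)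
      = ∫ x in Ω, u x * fderiv ℝ φ x (EuclideanSpace.single i 1) := by
    rw [← integral_indicator hΩ.measurableSet]
    congr 1
    ext x
    by_cases hx : x ∈ tsupport φ
    · have h3 := hφR hx
      rw [indicator_of_mem (Metric.ball_subset_closedBall h3), indicator_of_mem (hBΩ h3)]
    · have h3 : fderiv ℝ φ x = 0 := by
        by_contra h
        exact hx (support_fderiv_subset ℝ h)
      by_cases hxΩ : x ∈ Ω <;> simp [h3, hxΩ]
  rw [h2, h1, norm_neg]
  calc ‖∫ x in Ω, g x i * φ x‖ ≤ ∫ x in Ω, C * φ x := by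
        refine norm_integral_le_of_norm_le (hφi.integrableOn.const_mul C) ?_
        filter_upwards [hg] with x hx
        by_cases hxR : x ∈ Metric.ball q R
        · rw [norm_mul, Real.norm_of_nonneg (hφ0 x)]
          exact mul_le_mul_of_nonneg_right ((PiLp.norm_apply_le (g x) i).trans (hx hxR)) (hφ0 x)
        · have : φ x = 0 := by
            by_contra h
            exact hxR (hφR (subset_tsupport φ h))
          simp [this]
    _ ≤ ∫ x, C * φ x := setIntegral_le_integral (hφi.const_mul C)
        (Eventually.of_forall fun x => mul_nonneg hC (hφ0 x))
    _ = C := by rw [integral_const_mul, hφ1, mul_one]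

theorem integrable_indicator_closedBall (hu : ContinuousOn u Ω) (hR : Metric.closedBall q R ⊆ Ω) :
    Integrable ((Metric.closedBall q R).indicator u) :=
  ((hu.mono hR).integrableOn_compact (isCompact_closedBall q R)).integrable_indicator
    Metric.isClosed_closedBall.measurableSet

theorem lipschitzOnWith_convolution (hΩ : IsOpen Ω) (hu : ContinuousOn u Ω)
    (hug : IsW12LocWithGradient Ω u g) (hR : Metric.closedBall q R ⊆ Ω) {C : ℝ≥0}
    (hg : ∀ᵐ x ∂(volume.restrict Ω), x ∈ Metric.ball q R → ‖g x‖ ≤ C)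
    (φ : ContDiffBump (0 : EuclideanSpace ℝ (Fin n))) {r : ℝ} (hr : r + φ.rOut ≤ R) :
    LipschitzOnWith (n * C) (φ.normed volume ⋆[lsmul ℝ ℝ, volume]
      (Metric.closedBall q R).indicator u) (Metric.ball q r) := by
  set ub := (Metric.closedBall q R).indicator u with hub
  have hubi : Integrable ub := integrable_indicator_closedBall hu hR
  -- The smooth kernel must be the right factor for the derivative to fall on it.
  rw [← convolution_flip]
  have hderiv := fun x => (φ.hasCompactSupport_normed (μ := volume)).hasFDerivAt_convolution_right
    (lsmul ℝ ℝ).flip hubi.locallyIntegrable (φ.contDiff_normed (n := 1)) x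
  refine (convex_ball q r).lipschitzOnWith_of_nnnorm_hasFDerivWithin_le
    (fun x _ => (hderiv x).hasFDerivWithinAt) fun x hx => ?_
  rw [← NNReal.coe_le_coe, coe_nnnorm]
  push_cast
  refine norm_le_of_norm_apply_single_le C.2 fun i => ?_
  rw [convolution_precompR_apply _ hubi.locallyIntegrable (φ.hasCompactSupport_normed.fderiv ℝ)
    ((φ.contDiff_normed (n := 1)).continuous_fderiv (by simp)), convolution_def]
  have hψ : ContDiff ℝ ∞ fun y => φ.normed volume (x - y) :=
    φ.contDiff_normed.comp (contDiff_const.sub contDiff_id)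
  have hts : tsupport (fun y => φ.normed volume (x - y)) ⊆ Metric.closedBall x φ.rOut := by
    refine closure_minimal (fun y hy => ?_) Metric.isClosed_closedBall
    have h1 : x - y ∈ Function.support (φ.normed volume) := hy
    rw [φ.support_normed_eq] at h1
    rw [Metric.mem_closedBall, dist_comm, dist_eq_norm]
    simpa using (Metric.mem_ball.1 h1).le
  have hcs : HasCompactSupport fun y => φ.normed volume (x - y) :=
    (isCompact_closedBall x φ.rOut).of_isClosed_subset isClosed_closure hts
  have hfd : ∀ y, fderiv ℝ (fun y => φ.normed volume (x - y)) y
      = -fderiv ℝ (φ.normed volume) (x - y) := fun y => by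
    have h1 := ((φ.contDiff_normed (n := 1) (μ := volume)).differentiable (by simp)
      (x - y)).hasFDerivAt.comp y ((hasFDerivAt_id y).const_sub x)
    simpa using! h1.fderiv
  have key := norm_integral_mul_fderiv_le hΩ hug hR hg C.2 hψ hcs
    (hts.trans (Metric.closedBall_subset_ball' (by rw [Metric.mem_ball] at hx; linarith)))
    (fun y => φ.nonneg_normed _)
    (by rw [integral_sub_left_eq_self (φ.normed volume) volume x, φ.integral_normed]) i
  simp_rw [hfd, neg_apply, mul_neg] at key
  rw [integral_neg, norm_neg] at key
  simpa [mul_comm] using key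

/-- Quantifying over all bumps of outer radius ε lets one bump serve two points at once. -/
theorem eventually_dist_normed_convolution_le (hu : ContinuousOn u Ω) (hR : Metric.closedBall q R ⊆ Ω)
    {x : EuclideanSpace ℝ (Fin n)} (hx : x ∈ Metric.ball q R) {δ : ℝ} (hδ : 0 < δ) :
    ∀ᶠ ε in 𝓝[>] (0 : ℝ), ∀ φ : ContDiffBump (0 : EuclideanSpace ℝ (Fin n)), φ.rOut = ε →
      dist ((φ.normed volume ⋆[lsmul ℝ ℝ, volume] (Metric.closedBall q R).indicator u) x) (u x)
        ≤ δ := by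
  have hnhds : Metric.closedBall q R ∈ 𝓝 x :=
    mem_of_superset (Metric.isOpen_ball.mem_nhds hx) Metric.ball_subset_closedBall
  have hcont : ContinuousAt ((Metric.closedBall q R).indicator u) x :=
    ((hu.mono hR).continuousAt hnhds).congr
      (by filter_upwards [hnhds] with y hy; rw [indicator_of_mem hy])
  obtain ⟨ε₀, hε₀, hball⟩ := Metric.continuousAt_iff.1 hcont δ hδ
  filter_upwards [Ioo_mem_nhdsGT hε₀] with ε hε φ hφ
  have := φ.dist_normed_convolution_le (x₀ := x) (ε := δ)
    (integrable_indicator_closedBall hu hR).aestronglyMeasurable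
    fun y hy => (hball ((Metric.mem_ball.1 hy).trans (hφ ▸ hε.2))).le
  rwa [indicator_of_mem (Metric.ball_subset_closedBall hx)] at this

/-- A continuous function whose weak gradient is bounded on a ball is Lipschitz on that ball. -/
theorem IsW12LocWithGradient.lipschitzOnWith (hΩ : IsOpen Ω) (hu : ContinuousOn u Ω)
    (hug : IsW12LocWithGradient Ω u g) (hR : Metric.closedBall q R ⊆ Ω) {C : ℝ≥0}
    (hg : ∀ᵐ x ∂(volume.restrict Ω), x ∈ Metric.ball q R → ‖g x‖ ≤ C) :
    LipschitzOnWith (n * C) u (Metric.ball q R) := by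
  refine LipschitzOnWith.of_dist_le_mul fun x hx y hy => le_of_forall_pos_le_add fun δ hδ => ?_
  have hmax : max (dist x q) (dist y q) < R := max_lt hx hy
  -- The gap R - r is the room for the support of the kernel.
  obtain ⟨r, hr1, hr2⟩ := exists_between hmax
  have hxy := (eventually_dist_normed_convolution_le hu hR hx (half_pos hδ)).and
    ((eventually_dist_normed_convolution_le hu hR hy (half_pos hδ)).and
      (Ioo_mem_nhdsGT (sub_pos.2 hr2)))
  obtain ⟨ε, h1, h2, h3, h4⟩ := hxy.exists
  let φ : ContDiffBump (0 : EuclideanSpace ℝ (Fin n)) := ⟨ε / 2, ε, half_pos h3, half_lt_self h3⟩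
  have h5 := (lipschitzOnWith_convolution hΩ hu hug hR hg φ (r := r)
    (by change r + ε ≤ R; linarith)).dist_le_mul x ((le_max_left _ _).trans_lt hr1) y
      ((le_max_right _ _).trans_lt hr1)
  have h6 := h1 φ rfl
  have h7 := h2 φ rfl
  rw [dist_comm] at h6
  calc dist (u x) (u y) ≤ _ := dist_triangle4 _ _ _ _
    _ ≤ δ / 2 + _ + δ / 2 := add_le_add (add_le_add h6 h5) h7
    _ = _ := by ring

/-- On a ball on which `u` agrees with a Lipschitz function `f`, its weak gradient is `∇f`. -/
theorem IsW12LocWithGradient.ae_eq_gradient (hΩ : IsOpen Ω)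
    (hug : IsW12LocWithGradient Ω u g) (hR : Metric.closedBall q R ⊆ Ω) {K : ℝ≥0}
    {f : EuclideanSpace ℝ (Fin n) → ℝ} (hf : LipschitzWith K f)
    (huf : EqOn u f (Metric.ball q R)) :
    ∀ᵐ x ∂(volume.restrict (Metric.ball q R)), g x = gradient f x := by
  have hBΩ : Metric.ball q R ⊆ Ω := Metric.ball_subset_closedBall.trans hR
  have hfin : IsFiniteMeasure (volume.restrict (Metric.ball q R)) :=
    ⟨by simpa using measure_ball_lt_top⟩
  have hcomp : ∀ i, ∀ᵐ x, x ∈ Metric.ball q R → g x i - gradient f x i = 0 := by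
    intro i
    have hgi : IntegrableOn (fun x => g x i) (Metric.ball q R) := by
      have h1 := (hug.memL2Loc_gradient _ hR (isCompact_closedBall q R)).mono_measure
        (Measure.restrict_mono Metric.ball_subset_closedBall le_rfl)
      exact (EuclideanSpace.proj (𝕜 := ℝ) i).integrable_comp (h1.integrable one_le_two)
    have hfi : IntegrableOn (fun x => gradient f x i) (Metric.ball q R) :=
      Integrable.of_bound ((EuclideanSpace.proj (𝕜 := ℝ) i).continuous.measurable.comp
        (measurable_gradient f)).aestronglyMeasurable K (Eventually.of_forall fun x =>
          (PiLp.norm_apply_le (gradient f x) i).trans (lipschitzWith_norm_gradient_le hf x))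
    refine Metric.isOpen_ball.ae_eq_zero_of_integral_contDiff_smul_eq_zero
      (hgi.sub hfi).locallyIntegrableOn fun φ hφ hφc hφR => ?_
    have hφ0 : ∀ x, x ∉ Metric.ball q R → φ x = 0 := fun x hx => by
      by_contra h
      exact hx (hφR (subset_tsupport φ h))
    have hφ0' : ∀ x, x ∉ Metric.ball q R → fderiv ℝ φ x = 0 := fun x hx => by
      by_contra h
      exact hx (hφR (support_fderiv_subset ℝ h))
    have h1 := hug.integral_eq φ hφ hφc (hφR.trans hBΩ) i
    have h2 := (hf.isW12LocWithGradient (Ω := Metric.ball q R)).integral_eq φ hφ hφc hφR i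
    rw [setIntegral_eq_of_subset_of_forall_sdiff_eq_zero hΩ.measurableSet hBΩ
        fun x hx => by simp [hφ0' x hx.2],
      setIntegral_eq_of_subset_of_forall_sdiff_eq_zero hΩ.measurableSet hBΩ
        fun x hx => by simp [hφ0 x hx.2],
      setIntegral_congr_fun Metric.isOpen_ball.measurableSet
        (g := fun x => f x * fderiv ℝ φ x (EuclideanSpace.single i 1))
        (fun x hx => by simp only [huf hx]), h2, neg_inj] at h1
    rw [← setIntegral_eq_integral_of_forall_compl_eq_zero
      (s := Metric.ball q R) fun x hx => by simp [hφ0 x hx]]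
    obtain ⟨D, hD⟩ := hφc.exists_bound_of_continuous hφ.continuous
    have hmul : ∀ h : EuclideanSpace ℝ (Fin n) → ℝ, IntegrableOn h (Metric.ball q R) →
        IntegrableOn (fun x => h x * φ x) (Metric.ball q R) := fun h hh =>
      hh.mul_bdd (c := D) hφ.continuous.aestronglyMeasurable (Eventually.of_forall hD)
    simp only [smul_eq_mul, mul_comm (φ _), sub_mul]
    rw [integral_sub (hmul _ hgi) (hmul _ hfi), h1, sub_self]
  rw [ae_restrict_iff' Metric.isOpen_ball.measurableSet]
  filter_upwards [ae_all_iff.2 hcomp] with x hx hxB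
  ext i
  exact sub_eq_zero.1 (hx i hxB)

end Mollification

/-- On a ball compactly contained in `Ω`, admissible functions are Lipschitz subsolutions. -/
theorem IsAdmissible.exists_isLipSubsolution {Ω : Set (EuclideanSpace ℝ (Fin n))} (hΩ : IsOpen Ω)
    {w : EuclideanSpace ℝ (Fin n) → ℝ} (hw : IsAdmissible Ω A w) {q : EuclideanSpace ℝ (Fin n)}
    {R M : ℝ} (hR : Metric.closedBall q R ⊆ Ω)
    (hA : UniformlyEllipticOn A M (Metric.ball q R)) :
    ∃ f, IsLipSubsolution A 1 (n * (√M).toNNReal) (Metric.ball q R) f ∧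
      EqOn w f (Metric.ball q R) := by
  obtain ⟨hc, g, hg, hH⟩ := hw
  have hBΩ : Metric.ball q R ⊆ Ω := Metric.ball_subset_closedBall.trans hR
  have hbound : ∀ᵐ x ∂(volume.restrict Ω), x ∈ Metric.ball q R →
      ‖g x‖ ≤ ((√M).toNNReal : ℝ) := by
    have h1 := (ae_restrict_iff' Metric.isOpen_ball.measurableSet).1 hA.isEllipticAt
    filter_upwards [ae_restrict_of_ae h1, hH] with x hx hx1 hxB
    rw [Real.coe_toNNReal _ (Real.sqrt_nonneg M)]
    refine Real.le_sqrt_of_sq_le ?_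
    obtain ⟨h2, h3, h4⟩ := hx hxB (g x)
    nlinarith [hA.nonneg]
  have hlip := hg.lipschitzOnWith hΩ hc hR hbound
  obtain ⟨f, hf, hwf⟩ := hlip.extend_real
  refine ⟨f, ⟨hf, ?_⟩, hwf⟩
  filter_upwards [hg.ae_eq_gradient hΩ hR hf hwf,
    ae_restrict_of_ae_restrict_of_subset hBΩ hH] with x hx hx1
  rw [← hx, one_pow]
  exact hx1

end

section

variable {n : ℕ} {A : EuclideanSpace ℝ (Fin n) → Matrix (Fin n) (Fin n) ℝ}
  {Ω : Set (EuclideanSpace ℝ (Fin n))} {u : EuclideanSpace ℝ (Fin n) → ℝ}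

theorem IsDiffusionMatrix.exists_uniformlyEllipticOn (hA : IsDiffusionMatrix Ω A)
    {q : EuclideanSpace ℝ (Fin n)} {R : ℝ} (hR : Metric.closedBall q R ⊆ Ω) :
    ∃ M, 1 ≤ M ∧ UniformlyEllipticOn A M (Metric.ball q R) := by
  obtain ⟨M, hM, h⟩ := hA.exists_isEllipticAt (isCompact_closedBall q R) hR
  have hBΩ : Metric.ball q R ⊆ Ω := Metric.ball_subset_closedBall.trans hR
  refine ⟨M, hM, by linarith, measure_ball_lt_top.ne,
    fun i j => (hA.aemeasurable i j).mono_set hBΩ, ?_⟩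
  filter_upwards [ae_restrict_of_ae_restrict_of_subset hBΩ h,
    ae_restrict_mem Metric.isOpen_ball.measurableSet] with x hx hxB
  exact hx (Metric.ball_subset_closedBall hxB)

/-! ### McShane-type interpolation by lattice operations -/

section LipSubsolution

variable {c : ℝ} {K : ℝ≥0} {B : Set (EuclideanSpace ℝ (Fin n))}
  {f : EuclideanSpace ℝ (Fin n) → ℝ}

theorem IsLipSubsolution.mono {K' : ℝ≥0} (hf : IsLipSubsolution A c K B f) (h : K ≤ K') :
    IsLipSubsolution A c K' B f :=
  ⟨hf.lipschitzWith.weaken h, hf.ae_le⟩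

theorem isLipSubsolution_const (a : ℝ) : IsLipSubsolution A c K B fun _ => a where
  lipschitzWith := LipschitzWith.const' a
  ae_le := Eventually.of_forall fun x => by
    rw [gradient_fun_const, hamiltonian_zero]
    positivity

theorem _root_.LipschitzWith.const_add_const_mul (hf : LipschitzWith K f) (a b : ℝ) :
    LipschitzWith (‖b‖₊ * K) fun x => a + b * f x :=
  LipschitzWith.of_dist_le_mul fun x y => by
    rw [dist_add_left, dist_eq_norm, ← mul_sub, norm_mul, ← dist_eq_norm]
    push_cast
    rw [mul_assoc]
    exact mul_le_mul_of_nonneg_left (hf.dist_le_mul x y) (norm_nonneg _)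

theorem IsLipSubsolution.const_add_const_mul (hf : IsLipSubsolution A c K B f) (a b : ℝ) :
    IsLipSubsolution A (b * c) (‖b‖₊ * K) B fun x => a + b * f x where
  lipschitzWith := hf.lipschitzWith.const_add_const_mul a b
  ae_le := by
    filter_upwards [hf.ae_le] with x hx
    rw [gradient_const_add (fun y => b * f y), gradient_const_mul, hamiltonian_smul, mul_pow]
    exact mul_le_mul_of_nonneg_left hx (sq_nonneg b)

/-- The lattice form of the McShane extension: if for any two points of `B` there is a
subsolution equal to `u` at the first and below `u` at the second, then `u` is itself one on `B`. -/
theorem ae_hamiltonian_le_of_interpolation {M : ℝ} (hA : UniformlyEllipticOn A M B)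
    (hB : IsOpen B) (hc : 0 ≤ c) (hu : ContinuousOn u B)
    (h : ∀ z ∈ B, ∀ y ∈ B, ∃ f, IsLipSubsolution A c K B f ∧ f z = u z ∧ f y ≤ u y) :
    ∀ᵐ x ∂(volume.restrict B), hamiltonian A x (gradient u x) ≤ c ^ 2 := by
  rcases B.eq_empty_or_nonempty with rfl | hne
  · simp
  have : Nonempty B := hne.to_subtype
  set Z : ℕ → B := TopologicalSpace.denseSeq B with hZ
  choose f hf hfz hfy using fun i j : ℕ => h (Z i) (Z i).2 (Z j) (Z j).2
  have hdist : ∀ {g : EuclideanSpace ℝ (Fin n) → ℝ}, LipschitzWith K g → ∀ x y,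
      g x ≤ g y + K * dist x y := fun hg x y => by
    have := (le_abs_self _).trans (hg.dist_le_mul x y)
    linarith
  have hbelow : ∀ i x, BddBelow (range fun j => f i j x) := fun i x =>
    ⟨u (Z i) - K * dist (Z i : EuclideanSpace ℝ (Fin n)) x, forall_mem_range.2 fun j => by
      have := hdist (hf i j).lipschitzWith (Z i) x
      rw [hfz] at this
      linarith⟩
  have hG : ∀ i, IsLipSubsolution A c K B fun x => ⨅ j, f i j x := fun i =>
    IsLipSubsolution.ciInf hA hB.measurableSet hc (hf i) (hbelow i)
  have hGle : ∀ i j, ⨅ k, f i k (Z j) ≤ u (Z j) := fun i j =>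
    (ciInf_le (hbelow i (Z j)) j).trans (hfy i j)
  have habove : ∀ x, BddAbove (range fun i => ⨅ j, f i j x) := fun x =>
    ⟨u (Z 0) + K * dist x (Z 0), forall_mem_range.2 fun i =>
      (hdist (hG i).lipschitzWith x (Z 0)).trans (by simpa using hGle i 0)⟩
  have hF := IsLipSubsolution.ciSup hA hB.measurableSet hc hG habove
  have hFu : EqOn (fun x => ⨆ i, ⨅ j, f i j x) u B := by
    have heq : (fun x : B => ⨆ i, ⨅ j, f i j x) = fun x : B => u x := by
      refine (TopologicalSpace.denseRange_denseSeq B).equalizer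
        (hF.lipschitzWith.continuous.comp continuous_subtype_val) hu.domRestrict ?_
      ext j
      -- At `Z j` each infimum is at most u, through its index j; the one with i = j equals u, since
      -- every `f j k` does there.
      refine le_antisymm (ciSup_le fun i => hGle i j) ?_
      refine le_trans ?_ (le_ciSup (habove (Z j)) j)
      exact le_ciInf fun k => (hfz j k).ge
    exact fun x hx => congrFun heq ⟨x, hx⟩
  filter_upwards [hF.ae_le, ae_restrict_mem hB.measurableSet] with x hx hxB
  rwa [(hFu.eventuallyEq_of_mem (hB.mem_nhds hxB)).gradient_eq] at hx

end LipSubsolution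

/-! ### The lower bound `H(x, ∇u(x)) ≤ |Du|²(x)` -/

/-- A nearly optimal competitor for the intrinsic distance, scaled by c and shifted to match u at z,
is the interpolant for the pair. Its Lipschitz constant depends only on c, n and the ellipticity on
the ball, as the interpolation lemma requires. -/
theorem ae_hamiltonian_le_of_lipConst_lt (hΩ : IsOpen Ω) (hA : IsDiffusionMatrix Ω A)
    {q : EuclideanSpace ℝ (Fin n)} {R c : ℝ} (hR : Metric.closedBall q R ⊆ Ω)
    (hu : ContinuousOn u Ω) (hc : 0 < c)
    (h : lipConst Ω A u (Metric.ball q R) < ENNReal.ofReal c) :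
    ∀ᵐ x ∂(volume.restrict (Metric.ball q R)), hamiltonian A x (gradient u x) ≤ c ^ 2 := by
  obtain ⟨M, -, hM⟩ := hA.exists_uniformlyEllipticOn hR
  have hBΩ : Metric.ball q R ⊆ Ω := Metric.ball_subset_closedBall.trans hR
  refine ae_hamiltonian_le_of_interpolation (K := ‖c‖₊ * (n * (√M).toNNReal)) hM
    Metric.isOpen_ball hc.le (hu.mono hBΩ) fun z hz y hy => ?_
  rcases le_or_gt (u z) (u y) with hzy | hzy
  · exact ⟨fun _ => u z, isLipSubsolution_const _, rfl, hzy⟩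
  have hne : y ≠ z := by
    rintro rfl
    exact hzy.false
  have h1 : ENNReal.ofReal |u y - u z| / intrinsicDist Ω A z y < ENNReal.ofReal c :=
    lt_of_le_of_lt (le_iSup₂_of_le z hz (le_iSup₂_of_le y hy
      (le_iSup (fun _ : y ≠ z => ENNReal.ofReal |u y - u z| / intrinsicDist Ω A z y) hne))) h
  have hpos : 0 < |u y - u z| := abs_pos.2 (sub_ne_zero.2 hzy.ne)
  rw [ENNReal.div_lt_iff (Or.inr (ENNReal.ofReal_pos.2 hpos).ne') (Or.inr ENNReal.ofReal_ne_top),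
    intrinsicDist] at h1
  simp only [ENNReal.mul_iSup, lt_iSup_iff] at h1
  obtain ⟨w, hw, h1⟩ := h1
  rw [← ENNReal.ofReal_mul hc.le] at h1
  have h2 := (ENNReal.ofReal_lt_ofReal_iff_of_nonneg hpos.le).1 h1
  rw [abs_of_neg (sub_neg.2 hzy)] at h2
  obtain ⟨f, hf, hwf⟩ := hw.exists_isLipSubsolution hΩ hR hM
  refine ⟨fun x => (u z - c * f z) + c * f x, by simpa using hf.const_add_const_mul _ c,
    by ring, ?_⟩
  rw [hwf hz, hwf hy] at h2
  linarith

/-- The exceptional set depends on the ball and on c, so only countably many are used: centres in a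
dense set, rational radii and rational c. -/
theorem ae_hamiltonian_le_localLip_sq (hΩ : IsOpen Ω) (hA : IsDiffusionMatrix Ω A)
    (hu : ContinuousOn u Ω) :
    ∀ᵐ x ∂(volume.restrict Ω),
      ENNReal.ofReal (hamiltonian A x (gradient u x)) ≤ localLip Ω A u x ^ 2 := by
  obtain ⟨D, hDc, hDd⟩ := TopologicalSpace.exists_countable_dense (EuclideanSpace ℝ (Fin n))
  have key : ∀ᵐ x, ∀ q ∈ D, ∀ R c : ℚ, Metric.closedBall q (R : ℝ) ⊆ Ω → (0 : ℝ) < c →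
      lipConst Ω A u (Metric.ball q R) < ENNReal.ofReal c → x ∈ Metric.ball q (R : ℝ) →
      hamiltonian A x (gradient u x) ≤ (c : ℝ) ^ 2 := by
    refine (ae_ball_iff hDc).2 fun q _ => ae_all_iff.2 fun R => ae_all_iff.2 fun c => ?_
    by_cases h : Metric.closedBall q (R : ℝ) ⊆ Ω ∧ (0 : ℝ) < c ∧
        lipConst Ω A u (Metric.ball q R) < ENNReal.ofReal c
    · filter_upwards [(ae_restrict_iff' Metric.isOpen_ball.measurableSet).1
        (ae_hamiltonian_le_of_lipConst_lt hΩ hA h.1 hu h.2.1 h.2.2)] with x hx _ _ _ hxB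
      exact hx hxB
    · exact Eventually.of_forall fun x h1 h2 h3 => absurd ⟨h1, h2, h3⟩ h
  filter_upwards [ae_restrict_of_ae key, ae_restrict_mem hΩ.measurableSet] with x hx hxΩ
  have hlt : ∀ c : ℚ, localLip Ω A u x < ENNReal.ofReal c →
      hamiltonian A x (gradient u x) ≤ (c : ℝ) ^ 2 := by
    intro c hc
    have hc0 : (0 : ℝ) < c := ENNReal.ofReal_pos.1 (zero_le.trans_lt hc)
    simp only [localLip, iInf_lt_iff] at hc
    obtain ⟨r, hr, hc⟩ := hc
    obtain ⟨s, hs, hsΩ⟩ := Metric.isOpen_iff.1 hΩ x hxΩ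
    -- Since q lies within R of x, the ball around q is within 2R < min r s of x.
    obtain ⟨R, hR0, hR⟩ := exists_rat_btwn (show (0 : ℝ) < min r s / 2 by positivity)
    obtain ⟨q, hq, hxq⟩ := hDd.exists_mem_open (Metric.isOpen_ball (x := x) (ε := R))
      ⟨x, Metric.mem_ball_self hR0⟩
    have hmin := min_le_left r s
    have hmin' := min_le_right r s
    rw [Metric.mem_ball] at hxq
    have hsub : Metric.closedBall q (R : ℝ) ⊆ Ω :=
      (Metric.closedBall_subset_ball' (by linarith)).trans hsΩ
    refine hx q hq R c hsub hc0 (lt_of_le_of_lt (lipConst_mono Ω A u (subset_inter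
      (Metric.ball_subset_ball' (by linarith)) (Metric.ball_subset_closedBall.trans hsub))) hc) ?_
    rwa [Metric.mem_ball, dist_comm]
  by_cases htop : localLip Ω A u x = ⊤
  · simp [htop]
  rw [← ENNReal.ofReal_toReal htop, ← ENNReal.ofReal_pow ENNReal.toReal_nonneg]
  refine ENNReal.ofReal_le_ofReal ?_
  by_contra! hlt'
  obtain ⟨c, hc1, hc2⟩ := exists_rat_btwn (Real.lt_sqrt_of_sq_lt hlt')
  have hc0 : (0 : ℝ) < c := ENNReal.toReal_nonneg.trans_lt hc1
  have h1 := hlt c ((ENNReal.lt_ofReal_iff_toReal_lt htop).2 hc1)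
  exact absurd ((Real.lt_sqrt hc0.le).1 hc2) (not_lt.2 h1)

/-! ### The upper bound under weak upper semicontinuity -/

/-- If `H(y, ∇u(y)) ≤ c²` for almost every `y` near `x`, then `|Du|(x) ≤ c`: truncating `u / c` by
a cone produces an admissible function that agrees with `u / c` near `x` up to a constant. -/
theorem localLip_le_of_ae_hamiltonian_le (hΩ : IsOpen Ω) (hA : IsDiffusionMatrix Ω A)
    {x : EuclideanSpace ℝ (Fin n)} (hx : x ∈ Ω) (hu : ContDiffAt ℝ 1 u x) {c r₀ : ℝ}
    (hc : 0 < c) (hr₀ : 0 < r₀)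
    (h : ∀ᵐ y ∂(volume.restrict Ω), y ∈ Metric.ball x r₀ →
      hamiltonian A y (gradient u y) ≤ c ^ 2) :
    localLip Ω A u x ≤ ENNReal.ofReal c := by
  obtain ⟨K, t, ht, hK⟩ := hu.exists_lipschitzOnWith
  obtain ⟨s, hs, hst⟩ := Metric.mem_nhds_iff.1 (inter_mem ht (hΩ.mem_nhds hx))
  set r : ℝ := min r₀ (s / 2) with hr
  have hr0 : 0 < r := by positivity
  have hrs : Metric.closedBall x r ⊆ Metric.ball x s :=
    Metric.closedBall_subset_ball ((min_le_right _ _).trans_lt (half_lt_self hs))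
  have hrΩ : Metric.closedBall x r ⊆ Ω := fun y hy => (hst (hrs hy)).2
  have hBΩ : Metric.ball x r ⊆ Ω := Metric.ball_subset_closedBall.trans hrΩ
  obtain ⟨M, hM1, hM⟩ := hA.exists_uniformlyEllipticOn hrΩ
  obtain ⟨f, hf, huf⟩ := (hK.mono fun y hy =>
    (hst (hrs (Metric.ball_subset_closedBall hy))).1 : LipschitzOnWith K u
      (Metric.ball x r)).extend_real
  have hfx : f x = u x := (huf (Metric.mem_ball_self hr0)).symm
  have hsM : 0 < √M := Real.sqrt_pos.2 (by linarith)
  -- The steepest slope for which ellipticity guarantees H ≤ M k² = 1.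
  set k : ℝ := (√M)⁻¹ with hk
  have hk0 : 0 < k := inv_pos.2 hsM
  have hkM : M * k ^ 2 = 1 := by
    rw [hk, inv_pow, Real.sq_sqrt (by linarith)]
    exact mul_inv_cancel₀ (by linarith)
  set L : ℝ≥0 := max (‖c⁻¹‖₊ * K) ‖-k‖₊ with hL
  set w : EuclideanSpace ℝ (Fin n) → ℝ := fun y => -(c⁻¹ * u x) + c⁻¹ * f y with hw
  -- The cone has height kr/2 at x and reaches zero at distance r/2, so clamping w between ∓max(g,
  -- 0) yields a function vanishing outside the half ball.
  set g : EuclideanSpace ℝ (Fin n) → ℝ := fun y => k * r / 2 + -k * dist y x with hg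
  set v : EuclideanSpace ℝ (Fin n) → ℝ := fun y =>
    max (-max (g y) 0) (min (w y) (max (g y) 0)) with hv
  have hwsub : IsLipSubsolution A 1 L (Metric.ball x r) w := by
    refine IsLipSubsolution.mono ⟨hf.const_add_const_mul _ c⁻¹, ?_⟩ (le_max_left _ _)
    filter_upwards [ae_restrict_of_ae_restrict_of_subset hBΩ h,
      ae_restrict_mem Metric.isOpen_ball.measurableSet] with y hy hyB
    have h1 := hy (Metric.ball_subset_ball (min_le_left _ _) hyB)
    rw [hw, gradient_const_add (fun y => c⁻¹ * f y), gradient_const_mul, hamiltonian_smul,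
      ← (huf.eventuallyEq_of_mem (Metric.isOpen_ball.mem_nhds hyB)).gradient_eq]
    calc c⁻¹ ^ 2 * hamiltonian A y (gradient u y) ≤ c⁻¹ ^ 2 * c ^ 2 := by gcongr
      _ = 1 ^ 2 := by rw [← mul_pow, inv_mul_cancel₀ hc.ne']
  have hgsub : IsLipSubsolution A 1 L (Metric.ball x r) g := by
    have hglip : LipschitzWith ‖-k‖₊ g := by
      simpa [hg] using (LipschitzWith.dist_left x).const_add_const_mul (k * r / 2) (-k)
    refine IsLipSubsolution.mono ⟨hglip, ?_⟩ (le_max_right _ _)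
    filter_upwards [hM.isEllipticAt] with y hy
    refine ((hy _).2.2).trans ?_
    have h1 := lipschitzWith_norm_gradient_le hglip y
    rw [coe_nnnorm, norm_neg, Real.norm_of_nonneg hk0.le] at h1
    rw [one_pow, ← hkM]
    gcongr
  have hhsub := hgsub.sup (isLipSubsolution_const 0)
  have hvsub : IsLipSubsolution A 1 L (Metric.ball x r) v := hhsub.neg.sup (hwsub.inf hhsub)
  have hv0 : ∀ y, r / 2 ≤ dist y x → v y = 0 := fun y hy => by
    have hgy : g y ≤ 0 := by
      simp only [hg]
      nlinarith
    simp [hv, hgy]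
  have hadm : ∀ᵐ y ∂(volume.restrict Ω), hamiltonian A y (gradient v y) ≤ 1 := by
    filter_upwards [ae_restrict_of_ae
      ((ae_restrict_iff' Metric.isOpen_ball.measurableSet).1 hvsub.ae_le)] with y hy
    by_cases hyB : y ∈ Metric.ball x r
    · simpa using hy hyB
    · have h1 : v =ᶠ[𝓝 y] fun _ => 0 := by
        have h2 : (Metric.closedBall x (r / 2))ᶜ ∈ 𝓝 y :=
          Metric.isClosed_closedBall.isOpen_compl.mem_nhds fun h3 =>
            hyB (Metric.closedBall_subset_ball (half_lt_self hr0) h3)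
        filter_upwards [h2] with z hz
        exact hv0 z (not_le.1 (mt Metric.mem_closedBall.2 hz)).le
      rw [h1.gradient_eq, gradient_fun_const, hamiltonian_zero]
      exact zero_le_one
  have hvadm : IsAdmissible Ω A v :=
    ⟨hvsub.lipschitzWith.continuous.continuousOn, _, hvsub.lipschitzWith.isW12LocWithGradient, hadm⟩
  -- The distance is a supremum of signed differences; -v covers the other sign.
  have hvadm' : IsAdmissible Ω A fun y => -v y := by
    refine ⟨hvadm.1.neg, _, hvsub.lipschitzWith.neg.isW12LocWithGradient, ?_⟩
    filter_upwards [hadm] with y hy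
    change hamiltonian A y (gradient (fun z => -v z) y) ≤ 1
    rwa [gradient_neg_fun, hamiltonian_neg]
  -- Since w(x) = 0, |w| ≤ L·dist, while g = kr/2 - k·dist; the clamp is inactive as long as (L +
  -- k)·dist ≤ kr/2.
  set δ : ℝ := min r (k * r / 2 / (L + k)) with hδ
  have hLk : 0 < (L : ℝ) + k := by positivity
  have hδ0 : 0 < δ := by positivity
  have hvw : ∀ y ∈ Metric.ball x δ, v y = -(c⁻¹ * u x) + c⁻¹ * u y := fun y hy => by
    rw [Metric.mem_ball] at hy
    have hyw : w y = -(c⁻¹ * u x) + c⁻¹ * u y := by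
      rw [hw, huf (Metric.mem_ball.2 (hy.trans_le (min_le_left _ _)))]
    have h1 : |w y| ≤ L * dist y x := by
      have h2 := hwsub.lipschitzWith.dist_le_mul y x
      have h3 : w x = 0 := by simp [hw, hfx]
      rwa [h3, dist_zero_right, Real.norm_eq_abs] at h2
    have h2 : dist y x * (L + k) ≤ k * r / 2 :=
      (le_div_iff₀ hLk).1 (hy.le.trans (min_le_right _ _))
    have h3 : |w y| ≤ max (g y) 0 := le_max_of_le_left (by
      simp only [hg]
      linarith)
    rw [← hyw, hv]
    simp only
    rw [min_eq_left (abs_le.1 h3).2, max_eq_right (abs_le.1 h3).1]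
  refine (iInf₂_le δ hδ0).trans (iSup₂_le fun y hy => iSup₂_le fun z hz => iSup_le fun _ => ?_)
  refine ENNReal.div_le_of_le_mul ?_
  have hd : |u z - u y| = c * |v y - v z| := by
    rw [hvw y hy.1, hvw z hz.1, ← abs_of_pos hc, ← abs_mul, abs_of_pos hc, abs_sub_comm]
    congr 1
    field_simp
    ring
  rw [hd, ENNReal.ofReal_mul hc.le]
  gcongr
  rcases abs_choice (v y - v z) with h1 | h1
  · rw [h1]
    exact le_iSup₂_of_le v hvadm le_rfl
  · rw [h1]
    exact le_iSup₂_of_le _ hvadm' (by simp [neg_add_eq_sub])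

theorem WeakUSCAt.exists_ae_lt {f : EuclideanSpace ℝ (Fin n) → ℝ} {x : EuclideanSpace ℝ (Fin n)}
    (hf : WeakUSCAt Ω f x) (hΩ : MeasurableSet Ω) {t : ℝ} (ht : f x < t) :
    ∃ r > 0, ∀ᵐ y ∂(volume.restrict Ω), y ∈ Metric.ball x r → f y < t := by
  obtain ⟨E, hE, h⟩ := hf
  have h1 := eventually_lt_of_limsup_lt (h.trans_lt (EReal.coe_lt_coe_iff.2 ht))
  obtain ⟨r, hr, h2⟩ := Metric.mem_nhdsWithin_iff.1 h1
  refine ⟨r, hr, ?_⟩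
  filter_upwards [ae_restrict_of_ae (measure_eq_zero_iff_ae_notMem.1 hE), ae_restrict_mem hΩ]
    with y hyE hyΩ hy
  exact EReal.coe_lt_coe_iff.1 (h2 ⟨hy, hyΩ, hyE⟩)

/-- Homogeneity of H extends the hypothesis from unit vectors to all ξ, so that a countable dense
subset of the whole space can be used. -/
theorem WeakUSCOn.ae_exists_ae_lt (h : WeakUSCOn Ω A) (hΩ : MeasurableSet Ω)
    (ξ : EuclideanSpace ℝ (Fin n)) :
    ∀ᵐ x ∂(volume.restrict Ω), ∀ t, hamiltonian A x ξ < t → ∃ r > 0,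
      ∀ᵐ y ∂(volume.restrict Ω), y ∈ Metric.ball x r → hamiltonian A y ξ < t := by
  rcases eq_or_ne ξ 0 with rfl | hξ
  · simp only [hamiltonian_zero]
    exact Eventually.of_forall fun x t ht => ⟨1, one_pos, Eventually.of_forall fun _ _ => ht⟩
  have hξ0 : 0 < ‖ξ‖ := norm_pos_iff.2 hξ
  have hH : ∀ y, hamiltonian A y ξ = ‖ξ‖ ^ 2 * hamiltonian A y (‖ξ‖⁻¹ • ξ) := fun y => by
    rw [← hamiltonian_smul, smul_inv_smul₀ hξ0.ne']
  have hsphere : ‖ξ‖⁻¹ • ξ ∈ Metric.sphere (0 : EuclideanSpace ℝ (Fin n)) 1 := by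
    rw [mem_sphere_zero_iff_norm, norm_smul, norm_inv, norm_norm, inv_mul_cancel₀ hξ0.ne']
  filter_upwards [h _ hsphere] with x hx t ht
  simp only [hH, ← lt_div_iff₀' (pow_pos hξ0 2)] at ht ⊢
  exact hx.exists_ae_lt hΩ ht

/-- The null set in weak upper semicontinuity depends on the direction, so ∇u(x) is replaced by a
nearby ξ from a countable dense set; ellipticity absorbs the error. -/
theorem ae_localLip_sq_le (hΩ : IsOpen Ω) (hA : IsDiffusionMatrix Ω A) (h : WeakUSCOn Ω A)
    (hu : ContDiffOn ℝ 1 u Ω) :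
    ∀ᵐ x ∂(volume.restrict Ω),
      localLip Ω A u x ^ 2 ≤ ENNReal.ofReal (hamiltonian A x (gradient u x)) := by
  obtain ⟨D, hDc, hDd⟩ := TopologicalSpace.exists_countable_dense (EuclideanSpace ℝ (Fin n))
  filter_upwards [(ae_ball_iff hDc).2 fun ξ _ => h.ae_exists_ae_lt hΩ.measurableSet ξ,
    hA.ae_hamiltonian_nonneg hΩ.measurableSet, ae_restrict_mem hΩ.measurableSet] with x hx hx0 hxΩ
  set p := gradient u x with hp
  have hux : ContDiffAt ℝ 1 u x := hu.contDiffAt (hΩ.mem_nhds hxΩ)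
  have hmain : ∀ c : ℝ, √(hamiltonian A x p) < c → localLip Ω A u x ≤ ENNReal.ofReal c := by
    intro c hc
    obtain ⟨c₁, hc₁, hc₁c⟩ := exists_between hc
    have hc₁0 : 0 < c₁ := (Real.sqrt_nonneg _).trans_lt hc₁
    obtain ⟨s, hs, hsΩ⟩ := Metric.nhds_basis_closedBall.mem_iff.1 (hΩ.mem_nhds hxΩ)
    obtain ⟨M, hM1, hM⟩ := hA.exists_uniformlyEllipticOn hsΩ
    have hsM : 0 < √M := Real.sqrt_pos.2 (by linarith)
    -- Two errors of size δ, from ∇u(y) to ∇u(x) and from ∇u(x) to ξ, cost at most 2δ√M = c - c₁ in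
    -- √H.
    set δ : ℝ := (c - c₁) / (2 * √M) with hδ
    have hδ0 : 0 < δ := div_pos (sub_pos.2 hc₁c) (by positivity)
    obtain ⟨ξ, hξD, hξ⟩ := hDd.exists_mem_open
      (U := {ξ | √(hamiltonian A x ξ) < c₁} ∩ Metric.ball p δ)
      ((isOpen_lt (continuous_hamiltonian x).sqrt continuous_const).inter Metric.isOpen_ball)
      ⟨p, hc₁, Metric.mem_ball_self hδ0⟩
    obtain ⟨r, hr, hr'⟩ := hx ξ hξD (c₁ ^ 2) ((Real.sqrt_lt' hc₁0).1 hξ.1)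
    have hcont : ContinuousAt (gradient u) x :=
      (InnerProductSpace.toDual ℝ _).symm.continuous.continuousAt.comp
        ((hu.continuousOn_fderiv_of_isOpen hΩ le_rfl).continuousAt (hΩ.mem_nhds hxΩ))
    obtain ⟨ρ, hρ, hρ'⟩ := Metric.continuousAt_iff.1 hcont δ hδ0
    refine localLip_le_of_ae_hamiltonian_le hΩ hA hxΩ hux (hc₁0.trans hc₁c)
      (r₀ := min r (min s ρ)) (by positivity) ?_
    filter_upwards [hr', ae_restrict_of_ae
      ((ae_restrict_iff' Metric.isOpen_ball.measurableSet).1 hM.isEllipticAt)] with y hy hyM hyB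
    simp only [Metric.mem_ball, lt_min_iff] at hyB
    have hye := hyM hyB.2.1
    have h1 : √(hamiltonian A y ξ) < c₁ := (Real.sqrt_lt' hc₁0).2 (hy hyB.1)
    have h2 : ‖gradient u y - ξ‖ ≤ 2 * δ := by
      rw [← dist_eq_norm]
      have h3 := dist_triangle_right (gradient u y) ξ p
      have h4 := Metric.mem_ball.1 hξ.2
      have h5 := hρ' hyB.2.2
      linarith
    have h3 := sqrt_hamiltonian_add_le (fun η => (hye η).1) ξ (gradient u y - ξ)
    rw [add_sub_cancel] at h3
    have h4 : √M * ‖gradient u y - ξ‖ ≤ c - c₁ := by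
      calc √M * ‖gradient u y - ξ‖ ≤ √M * (2 * δ) := by gcongr
        _ = c - c₁ := by
          rw [hδ]
          field_simp
    have h5 := hye.sqrt_hamiltonian_le (gradient u y - ξ)
    exact (Real.sqrt_le_left (hc₁0.trans hc₁c).le).1 (by linarith)
  have hle : localLip Ω A u x ≤ ENNReal.ofReal √(hamiltonian A x p) := by
    refine ENNReal.le_of_forall_pos_le_add fun ε hε _ => ?_
    have h1 := hmain (√(hamiltonian A x p) + ε) (lt_add_of_pos_right _ hε)
    rwa [ENNReal.ofReal_add (Real.sqrt_nonneg _) ε.coe_nonneg, ENNReal.ofReal_coe_nnreal] at h1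
  calc localLip Ω A u x ^ 2 ≤ ENNReal.ofReal √(hamiltonian A x p) ^ 2 := by gcongr
    _ = _ := by rw [← ENNReal.ofReal_pow (Real.sqrt_nonneg _), Real.sq_sqrt (hx0 p)]

/-! ### Weak upper semicontinuity from linear functions -/

/-- A ball contains a smaller ball around each of its points; this is the upper semicontinuity of
|Du|. -/
theorem localLip_le_lipConst_of_mem_ball {x y : EuclideanSpace ℝ (Fin n)} {r : ℝ}
    (hy : y ∈ Metric.ball x r) :
    localLip Ω A u y ≤ lipConst Ω A u (Metric.ball x r ∩ Ω) := by
  rw [Metric.mem_ball] at hy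
  exact (iInf₂_le (r - dist y x) (sub_pos.2 hy)).trans (lipConst_mono Ω A u
    (inter_subset_inter_left _ (Metric.ball_subset_ball' (by linarith))))

theorem gradient_inner_left (ξ x : EuclideanSpace ℝ (Fin n)) :
    gradient (fun y => ⟪ξ, y⟫) x = ξ := by
  refine ext_inner_right ℝ fun v => ?_
  rw [inner_gradient_left]
  change fderiv ℝ (innerSL ℝ ξ) x v = _
  rw [ContinuousLinearMap.fderiv, innerSL_apply_apply]

theorem weakUSCOn_of_forall_localLip_sq_eq (hΩ : MeasurableSet Ω) (hA : IsDiffusionMatrix Ω A)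
    (h : ∀ ξ : EuclideanSpace ℝ (Fin n), ∀ᵐ x ∂(volume.restrict Ω),
      localLip Ω A (fun y => ⟪ξ, y⟫) x ^ 2 = ENNReal.ofReal (hamiltonian A x ξ)) :
    WeakUSCOn Ω A := by
  intro ξ _
  have hae := (h ξ).and (hA.ae_hamiltonian_nonneg hΩ)
  filter_upwards [hae] with x hx
  -- The set E consists of the points of Ω where the identity or the nonnegativity of H fails.
  have hnull := (ae_restrict_iff' hΩ).1 hae
  refine ⟨_, ae_iff.1 hnull, ?_⟩
  refine EReal.le_of_forall_lt_iff_le.1 fun t ht => limsup_le_of_le (h := ?_)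
  have ht' := EReal.coe_lt_coe_iff.1 ht
  -- Positivity of t is needed because `ENNReal.ofReal` collapses nonpositive reals to 0.
  have ht0 : 0 < t := (hx.2 ξ).trans_lt ht'
  have hlim := ENNReal.Tendsto.pow (n := 2) (tendsto_localLip Ω A (fun y => ⟪ξ, y⟫) x)
  rw [hx.1] at hlim
  obtain ⟨r, hr, hr0⟩ := ((hlim.eventually_lt_const
    ((ENNReal.ofReal_lt_ofReal_iff ht0).2 ht')).and self_mem_nhdsWithin).exists
  filter_upwards [self_mem_nhdsWithin,
    mem_nhdsWithin_of_mem_nhds (Metric.ball_mem_nhds x hr0)] with y hy hyB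
  have hy' := not_not.1 hy.2 hy.1
  have h1 : ENNReal.ofReal (hamiltonian A y ξ) < ENNReal.ofReal t := by
    rw [← hy'.1]
    exact lt_of_le_of_lt (by gcongr; exact localLip_le_lipConst_of_mem_ball hyB) hr
  exact EReal.coe_le_coe_iff.2 ((ENNReal.ofReal_lt_ofReal_iff ht0).1 h1).le

end

end IntrinsicDistance

theorem theorem2p3 (n : ℕ) (hn : 1 ≤ n) (Ω : Set (EuclideanSpace ℝ (Fin n)))
    (hΩ_open : IsOpen Ω) (hΩ_conn : IsConnected Ω)
    (A : EuclideanSpace ℝ (Fin n) → Matrix (Fin n) (Fin n) ℝ)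
    (hA : IntrinsicDistance.IsDiffusionMatrix Ω A) :
    IntrinsicDistance.WeakUSCOn Ω A ↔
      ∀ u : EuclideanSpace ℝ (Fin n) → ℝ, ContDiffOn ℝ 1 u Ω →
        ∀ᵐ x ∂(volume.restrict Ω),
          IntrinsicDistance.localLip Ω A u x ^ 2
            = ENNReal.ofReal (IntrinsicDistance.hamiltonian A x (gradient u x)) := by
  refine ⟨fun h u hu => ?_, fun h => ?_⟩
  · filter_upwards [IntrinsicDistance.ae_localLip_sq_le hΩ_open hA h hu,
      IntrinsicDistance.ae_hamiltonian_le_localLip_sq hΩ_open hA hu.continuousOn] with x h1 h2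
    exact le_antisymm h1 h2
  · refine IntrinsicDistance.weakUSCOn_of_forall_localLip_sq_eq hΩ_open.measurableSet hA
      fun ξ => ?_
    filter_upwards [h (fun y => inner ℝ ξ y) (contDiff_const.inner ℝ contDiff_id).contDiffOn]
      with x hx
    rwa [IntrinsicDistance.gradient_inner_left] at hx
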